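/- Let $n$ and $r$ be integers with $1\le r<n/2$. Build a random intersecting family of $r$-subsets of $[n]=\{1,\dots,n\}$ as follows. Choose $e_1$ uniformly at random from $\binom{[n]}{r}$. Given $\mathcal F_i=\{e_1,\dots,e_i\}$, let $\mathcal A(\mathcal F_i)$ be the set of all $e\in\binom{[n]}{r}$ with $e\notin\mathcal F_i$ and $e\cap e_j\neq\emptyset$ for $1\le j\le i$. If $\mathcal A(\mathcal F_i)\ne\emptyset$, choose $e_{i+1}$ uniformly at random from $\mathcal A(\mathcal F_i)$; otherwise halt and output $\mathcal F=\mathcal F_i$. Let $\mathcal E_{n,r}$ be the event that $|\mathcal F|=\binom{n-1}{r-1}$. (i) For all integers $1\le r<n/2$ and every possible output $\mathcal F$ of the process, $|\mathcal F|=\binom{n-1}{r-1}$ if and only if there is an $x\in[n]$ that belongs to every member of $\mathcal F$. (ii) Let $r=r(n)$ be integers with $1\le r(n)<n/2$ for all sufficiently large $n$, and write $r(n)=c_n n^{1/3}$. Then $$\lim_{n\to\infty}\Pr(\mathcal E_{n,r(n)})=\begin{cases}1 & \text{if } c_n\to 0,\\ \dfrac{1}{1+c^3} & \text{if } c_n\to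 c \text{ for a real constant } c,\\ 0 & \text{if } c_n\to\infty.\end{cases}$$ -/

import Mathlib

open Filter Topology

/-- The `r`-subsets of `[n]` that are not yet in the family `F` and meet every member of `F`.
For `F = ∅` these are all `r`-subsets of `[n]`. -/
def admissible (n r : ℕ) (F : Finset (Finset (Fin n))) : Finset (Finset (Fin n)) :=
  (Finset.powersetCard r Finset.univ).filter (fun e => e ∉ F ∧ ∀ f ∈ F, (e ∩ f).Nonempty)

open Classical in
/-- One step of the process: if some admissible set is left, add one chosen uniformly at random;
otherwise the process has halted and the family does not change any more. -/
noncomputable def step (n r : ℕ) (F : Finset (Finset (Fin n))) : PMF (Finset (Finset (Fin n))) :=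
  if h : (admissible n r F).Nonempty then
    (PMF.uniformOfFinset (admissible n r F) h).map (fun e => insert e F)
  else PMF.pure F

/-- The law of the family `F_i = {e_1, …, e_i}` after `i` steps (or of the final family, if the
process halts before step `i`). -/
noncomputable def familyLaw (n r : ℕ) : ℕ → PMF (Finset (Finset (Fin n)))
  | 0 => PMF.pure ∅
  | i + 1 => (familyLaw n r i).bind (step n r)

/-- The law of the output of the process. There are only `n.choose r` sets to choose from, and sets
are chosen without replacement, so the process has halted after `n.choose r` steps
(see `admissible_eq_empty_of_mem_support`). -/
noncomputable def outputLaw (n r : ℕ) : PMF (Finset (Finset (Fin n))) :=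
  familyLaw n r (n.choose r)

theorem familyLaw_support (n r i : ℕ) (F : Finset (Finset (Fin n)))
    (hF : F ∈ (familyLaw n r i).support) :
    F ⊆ Finset.powersetCard r Finset.univ ∧ (admissible n r F = ∅ ∨ F.card = i) := by
  induction i generalizing F with
  | zero =>
    have h : F = ∅ := by simpa [familyLaw] using hF
    subst h
    simp
  | succ i ih =>
    rw [familyLaw, PMF.mem_support_bind_iff] at hF
    obtain ⟨G, hG, hGF⟩ := hF
    obtain ⟨h1, h2⟩ := ih G hG
    by_cases h : (admissible n r G).Nonempty
    · rw [step, dif_pos h, PMF.mem_support_map_iff] at hGF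
      obtain ⟨e, he, rfl⟩ := hGF
      rw [PMF.mem_support_uniformOfFinset_iff] at he
      have he' := he
      rw [admissible, Finset.mem_filter] at he'
      refine ⟨Finset.insert_subset he'.1 h1, Or.inr ?_⟩
      rcases h2 with h2 | h2
      · simp [h2] at he
      · rw [Finset.card_insert_of_notMem he'.2.1, h2]
    · rw [step, dif_neg h, PMF.mem_support_pure_iff] at hGF
      subst hGF
      exact ⟨h1, Or.inl (Finset.not_nonempty_iff_eq_empty.mp h)⟩

/-- The process has halted: no admissible set is left for an output family. -/
theorem admissible_eq_empty_of_mem_support (n r : ℕ) (F : Finset (Finset (Fin n)))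
    (hF : F ∈ (outputLaw n r).support) : admissible n r F = ∅ := by
  obtain ⟨h1, h | h⟩ := familyLaw_support n r _ F hF
  · exact h
  · have hall : F = Finset.powersetCard r Finset.univ :=
      Finset.eq_of_subset_of_card_le h1 (by simp [h])
    subst hall
    ext e
    simp only [admissible, Finset.mem_filter, Finset.notMem_empty, iff_false]
    tauto

/-- The event that the family has the Erdős–Ko–Rado size `(n-1).choose (r-1)` (for `1 ≤ r`). -/
def ekrEvent (n r : ℕ) : Set (Finset (Finset (Fin n))) :=
  {F | F.card = (n - 1).choose (r - 1)}

/-- `F` is fixed by `x`: every member of `F` contains `x`. -/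
def FixedBy {n : ℕ} (F : Finset (Finset (Fin n))) (x : Fin n) : Prop :=
  ∀ e ∈ F, x ∈ e

/-- The probability that the output of the process has the Erdős–Ko–Rado size. -/
noncomputable def probEKR (n r : ℕ) : ℝ :=
  ((outputLaw n r).toOuterMeasure (ekrEvent n r)).toReal

/-! Part (i) is the Erdős–Ko–Rado theorem with uniqueness. If all members of an output share `x`,
maximality makes it the whole star of `x`. The converse uses Katona's cyclic orders: an intersecting
family has at most `r` arcs of length `r` in a cyclic order and a star has exactly `r`, so averaging
over all orders shows that a family as large as a star has `r` arcs in every order, and these are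
consecutive. Well-chosen orders then force a common element (`exists_fixedBy_of_card_eq`).

By (i), the probability in question is that the output has a common element. Write `N = (n-1).choose
(r-1)`. If `r²/n → 0`, the first two sets typically meet in a single element `x`. About `N`
candidates for the third set contain `x`, and about `(r-1)² * (n-2).choose (r-2) ≈ N r³/n` avoid it,
having an element in each of the first two sets. A third set of the second kind destroys the common
element, which gives `1/(1+c³)` as an upper bound (`probEKR_le_of_pair`). For the lower bound,
leaving the star later must be unlikely. With `Z = (n-1-r).choose (r-1)`, the number of `r`-sets
that avoid `x` and meet all sets chosen so far, divided by `Z`, bounds the probability of ever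
leaving (`iterate_stepMean_escape_le`). Since `N/Z → 1`, hardly anything is lost beyond the third
set (`one_sub_probEKR_le`). The case `c → 0` is the case `c₀ = 0`.

If `c → ∞`, three ranges of `r` are needed. For `r² ≤ 4n` the third set probably misses the
intersection of the first two (`probEKR_le_of_triple`). For larger `r` most `r`-sets stay
admissible, so the first `m` sets are nearly independent and a union bound over the common element
applies (`probEKR_le_of_prefix`), with `m = 3` while `r³` is small compared with `n²` and `m = √n`
beyond. -/

/-! ### The process as an averaging operator on functions of families. -/

section OneStep

variable {n r : ℕ}

/-- The expectation of `g` after one step of the process started at `F`. -/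
noncomputable def stepMean (n r : ℕ) (g : Finset (Finset (Fin n)) → ℝ)
    (F : Finset (Finset (Fin n))) : ℝ :=
  if (admissible n r F).Nonempty then
    (∑ e ∈ admissible n r F, g (insert e F)) / (admissible n r F).card
  else g F

/-- The expectation of a real function under a law on a finite type. -/
noncomputable def PMF.mean {α : Type*} [Fintype α] (p : PMF α) (g : α → ℝ) : ℝ :=
  ∑ a, (p a).toReal * g a

theorem PMF.mean_pure {α : Type*} [Fintype α] (a : α) (g : α → ℝ) :
    (PMF.pure a).mean g = g a := by
  classical
  rw [PMF.mean, Finset.sum_eq_single a]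
  · simp
  · intro b _ hb
    simp [PMF.pure_apply, hb]
  · simp

theorem PMF.mean_bind {α β : Type*} [Fintype α] [Fintype β] (p : PMF α) (f : α → PMF β)
    (g : β → ℝ) : (p.bind f).mean g = p.mean (fun a => (f a).mean g) := by
  simp only [PMF.mean, PMF.bind_apply, tsum_fintype, Finset.mul_sum]
  rw [Finset.sum_comm]
  refine Finset.sum_congr rfl fun b _ => ?_
  rw [ENNReal.toReal_sum (fun a _ => ENNReal.mul_ne_top (p.apply_ne_top a) ((f a).apply_ne_top b)),
    Finset.sum_mul]
  exact Finset.sum_congr rfl fun a _ => by rw [ENNReal.toReal_mul]; ring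

theorem PMF.mean_uniformOfFinset {α : Type*} [Fintype α] (s : Finset α) (hs : s.Nonempty)
    (g : α → ℝ) : (PMF.uniformOfFinset s hs).mean g = (∑ a ∈ s, g a) / s.card := by
  classical
  simp only [PMF.mean, PMF.uniformOfFinset_apply]
  rw [Finset.sum_div, ← Finset.sum_filter_add_sum_filter_not Finset.univ (· ∈ s)]
  rw [Finset.sum_eq_zero (s := Finset.univ.filter (fun a => ¬ a ∈ s)), add_zero]
  · rw [Finset.filter_mem_eq_inter, Finset.univ_inter]
    refine Finset.sum_congr rfl fun a ha => ?_
    simp [ha, div_eq_inv_mul]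
  · intro a ha
    simp [(Finset.mem_filter.mp ha).2]

theorem mean_step (g : Finset (Finset (Fin n)) → ℝ) (F : Finset (Finset (Fin n))) :
    (step n r F).mean g = stepMean n r g F := by
  unfold step stepMean
  split_ifs with h
  · rw [PMF.map, PMF.mean_bind, PMF.mean_uniformOfFinset]
    simp only [Function.comp_apply, PMF.mean_pure]
  · exact PMF.mean_pure F g

/-- In the iterate, the outermost application is the first step of the process and the innermost one
the last. Later inductions peel off the outermost one, that is, they condition on the next set. -/
theorem mean_familyLaw (i : ℕ) (g : Finset (Finset (Fin n)) → ℝ) :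
    (familyLaw n r i).mean g = (stepMean n r)^[i] g ∅ := by
  induction i generalizing g with
  | zero => exact PMF.mean_pure ∅ g
  | succ i ih =>
    rw [familyLaw, PMF.mean_bind, Function.iterate_succ_apply, ← ih]
    simp only [mean_step]

/-- Agreement is asked only on the support, because the size criterion for a common element holds
only for possible outputs. -/
theorem toReal_toOuterMeasure_eq_mean {α : Type*} [Fintype α] (p : PMF α) (s : Set α)
    (g : α → ℝ) (h1 : ∀ a ∈ p.support, a ∈ s → g a = 1)
    (h0 : ∀ a ∈ p.support, a ∉ s → g a = 0) :
    (p.toOuterMeasure s).toReal = p.mean g := by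
  classical
  rw [PMF.toOuterMeasure_apply, tsum_fintype, ENNReal.toReal_sum, PMF.mean]
  · refine Finset.sum_congr rfl fun a _ => ?_
    by_cases hp : p a = 0
    · simp [hp, Set.indicator_apply]
    · have hp' : a ∈ p.support := (PMF.mem_support_iff p a).mpr hp
      by_cases hs : a ∈ s
      · simp [hs, h1 a hp' hs]
      · simp [hs, h0 a hp' hs]
  · intro a _
    by_cases hs : a ∈ s <;> simp [hs, p.apply_ne_top]

theorem stepMean_mono {g h : Finset (Finset (Fin n)) → ℝ} (hgh : g ≤ h) :
    stepMean n r g ≤ stepMean n r h := by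
  intro F
  unfold stepMean
  split_ifs
  · exact div_le_div_of_nonneg_right (Finset.sum_le_sum fun e _ => hgh _) (Nat.cast_nonneg _)
  · exact hgh F

theorem iterate_stepMean_mono (k : ℕ) {g h : Finset (Finset (Fin n)) → ℝ} (hgh : g ≤ h) :
    (stepMean n r)^[k] g ≤ (stepMean n r)^[k] h :=
  (show Monotone (stepMean n r) from fun _ _ => stepMean_mono).iterate k hgh

theorem stepMean_const (c : ℝ) : stepMean n r (fun _ => c) = fun _ => c := by
  funext F
  unfold stepMean
  split_ifs with h
  · rw [Finset.sum_const, nsmul_eq_mul]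
    have : ((admissible n r F).card : ℝ) ≠ 0 := by exact_mod_cast h.card_pos.ne'
    field_simp
  · rfl

theorem iterate_stepMean_const (k : ℕ) (c : ℝ) :
    (stepMean n r)^[k] (fun _ => c) = fun _ => c :=
  Function.iterate_fixed (stepMean_const c) k

theorem stepMean_sub (g h : Finset (Finset (Fin n)) → ℝ) :
    stepMean n r (g - h) = stepMean n r g - stepMean n r h := by
  funext F
  simp only [stepMean, Pi.sub_apply]
  split_ifs
  · rw [Finset.sum_sub_distrib, sub_div]
  · rfl

theorem iterate_stepMean_sub (k : ℕ) (g h : Finset (Finset (Fin n)) → ℝ) :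
    (stepMean n r)^[k] (g - h) = (stepMean n r)^[k] g - (stepMean n r)^[k] h := by
  induction k generalizing g h with
  | zero => rfl
  | succ k ih => simp only [Function.iterate_succ_apply, stepMean_sub, ih]

theorem stepMean_sum {ι : Type*} (s : Finset ι) (g : ι → Finset (Finset (Fin n)) → ℝ) :
    stepMean n r (fun F => ∑ i ∈ s, g i F) = fun F => ∑ i ∈ s, stepMean n r (g i) F := by
  funext F
  simp only [stepMean]
  split_ifs
  · rw [Finset.sum_comm, Finset.sum_div]
  · rfl

theorem iterate_stepMean_sum {ι : Type*} (k : ℕ) (s : Finset ι)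
    (g : ι → Finset (Finset (Fin n)) → ℝ) :
    (stepMean n r)^[k] (fun F => ∑ i ∈ s, g i F) =
      fun F => ∑ i ∈ s, (stepMean n r)^[k] (g i) F := by
  induction k generalizing g with
  | zero => rfl
  | succ k ih => simp only [Function.iterate_succ_apply, stepMean_sum, ih]

theorem stepMean_of_nonempty {F : Finset (Finset (Fin n))} (h : (admissible n r F).Nonempty)
    (g : Finset (Finset (Fin n)) → ℝ) : stepMean n r g F =
      (∑ e ∈ admissible n r F, g (insert e F)) / (admissible n r F).card := by
  rw [stepMean, if_pos h]

theorem stepMean_le_of_forall {F : Finset (Finset (Fin n))} (h : (admissible n r F).Nonempty)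
    {g : Finset (Finset (Fin n)) → ℝ} {c : ℝ}
    (hg : ∀ e ∈ admissible n r F, g (insert e F) ≤ c) : stepMean n r g F ≤ c := by
  rw [stepMean_of_nonempty h, div_le_iff₀ (by exact_mod_cast h.card_pos)]
  calc _ ≤ ∑ e ∈ admissible n r F, c := Finset.sum_le_sum hg
    _ = _ := by rw [Finset.sum_const, nsmul_eq_mul, mul_comm]

open Classical in
/-- The indicator of the families all of whose members contain `x`. -/
noncomputable def fixedInd (x : Fin n) (F : Finset (Finset (Fin n))) : ℝ :=
  if FixedBy F x then 1 else 0

open Classical in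
/-- The indicator of the families whose members have a common element. -/
noncomputable def commonInd (F : Finset (Finset (Fin n))) : ℝ :=
  if ∃ x : Fin n, FixedBy F x then 1 else 0

theorem fixedInd_nonneg (x : Fin n) (F : Finset (Finset (Fin n))) : 0 ≤ fixedInd x F := by
  unfold fixedInd; split_ifs <;> norm_num

theorem commonInd_nonneg (F : Finset (Finset (Fin n))) : 0 ≤ commonInd F := by
  unfold commonInd; split_ifs <;> norm_num

theorem commonInd_le_one (F : Finset (Finset (Fin n))) : commonInd F ≤ 1 := by
  unfold commonInd; split_ifs <;> norm_num

theorem fixedInd_le_commonInd (x : Fin n) : fixedInd x ≤ commonInd := by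
  intro F
  unfold fixedInd
  split_ifs with h
  · rw [commonInd, if_pos ⟨x, h⟩]
  · exact commonInd_nonneg F

theorem commonInd_le_sum_fixedInd (F : Finset (Finset (Fin n))) :
    commonInd F ≤ ∑ x, fixedInd x F := by
  unfold commonInd
  split_ifs with h
  · obtain ⟨x, hx⟩ := h
    calc (1 : ℝ) = fixedInd x F := by rw [fixedInd, if_pos hx]
      _ ≤ _ := Finset.single_le_sum (f := fun x => fixedInd x F)
        (fun y _ => fixedInd_nonneg y F) (Finset.mem_univ x)
  · exact Finset.sum_nonneg fun y _ => fixedInd_nonneg y F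

theorem FixedBy.mono {F G : Finset (Finset (Fin n))} {x : Fin n} (hFG : F ⊆ G)
    (h : FixedBy G x) : FixedBy F x := fun e he => h e (hFG he)

theorem commonInd_antitone {F G : Finset (Finset (Fin n))} (hFG : F ⊆ G) :
    commonInd G ≤ commonInd F := by
  by_cases h : ∃ x : Fin n, FixedBy G x
  · obtain ⟨x, hx⟩ := h
    rw [commonInd, commonInd, if_pos ⟨x, hx⟩, if_pos ⟨x, hx.mono hFG⟩]
  · rw [commonInd, if_neg h]
    exact commonInd_nonneg F

theorem stepMean_commonInd_le : stepMean n r commonInd ≤ commonInd := by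
  intro F
  by_cases h : (admissible n r F).Nonempty
  · exact stepMean_le_of_forall h fun e _ => commonInd_antitone (Finset.subset_insert e F)
  · rw [stepMean, if_neg h]

/-- A lost common element never comes back, so the first few steps already give upper bounds for the
final probability. -/
theorem iterate_stepMean_commonInd_le {m k : ℕ} (h : m ≤ k) :
    (stepMean n r)^[k] commonInd ≤ (stepMean n r)^[m] commonInd :=
  (show Monotone (stepMean n r) from fun _ _ => stepMean_mono).antitone_iterate_of_map_le
    stepMean_commonInd_le h

theorem familyLaw_support_intersecting (hr : 1 ≤ r) (i : ℕ) (F : Finset (Finset (Fin n)))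
    (hF : F ∈ (familyLaw n r i).support) : (F : Set (Finset (Fin n))).Intersecting := by
  induction i generalizing F with
  | zero =>
    have h : F = ∅ := by simpa [familyLaw] using hF
    subst h
    simp [Set.Intersecting]
  | succ i ih =>
    rw [familyLaw, PMF.mem_support_bind_iff] at hF
    obtain ⟨G, hG, hGF⟩ := hF
    by_cases h : (admissible n r G).Nonempty
    · rw [step, dif_pos h, PMF.mem_support_map_iff] at hGF
      obtain ⟨e, he, rfl⟩ := hGF
      rw [PMF.mem_support_uniformOfFinset_iff, admissible, Finset.mem_filter] at he
      rw [Finset.coe_insert]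
      refine (ih G hG).insert ?_ fun f hf => ?_
      · rintro rfl
        simp at he
        omega
      · rw [Finset.disjoint_iff_inter_eq_empty]
        exact (he.2.2 f hf).ne_empty
    · rw [step, dif_neg h, PMF.mem_support_pure_iff] at hGF
      exact hGF ▸ ih G hG

end OneStep

/-! ### Katona's method: arcs of cyclic orders. -/

section CyclicOrders

/-- Seen from `i`, every element of `S` lies less than `r` steps ahead or behind, hence in one of
the `r` pairs `{i + t, i + t - r}`. The two elements of a pair are `r` apart, so `S` contains at
most one of them, and exactly one from each pair if its size is `r`. -/
theorem card_le_of_cyclically_close {n r : ℕ} [NeZero n] (hn : 2 * r < n) {S : Finset (ZMod n)}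
    (hS : ∀ i ∈ S, ∀ d : ℕ, r ≤ d → d + r ≤ n → i + d ∉ S) {i : ZMod n} (hi : i ∈ S) :
    S.card ≤ r ∧
      (S.card = r → ∀ t < r, i + t ∈ S ∨ i + t - r ∈ S) := by
  classical
  -- Sends both `i + t` and `i + t - r` to the index `t` of their pair; the second has offset `t + n
  -- - r`.
  set φ : ZMod n → ℕ := fun j => if (j - i).val < r then (j - i).val else (j - i).val + r - n with hφ
  have hval : ∀ j : ZMod n, i + ((j - i).val : ZMod n) = j := fun j => by
    rw [ZMod.natCast_zmod_val]; ring
  have hlt : ∀ j : ZMod n, (j - i).val < n := fun j => ZMod.val_lt _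
  have hfar : ∀ j ∈ S, ¬ (j - i).val < r → n < (j - i).val + r := by
    intro j hj h
    by_contra h'
    exact hS i hi (j - i).val (not_lt.mp h) (not_lt.mp h') (by rwa [hval])
  have hmaps : ∀ j ∈ S, φ j ∈ Finset.range r := by
    intro j hj
    have := hlt j
    simp only [hφ, Finset.mem_range]
    split_ifs with h
    · exact h
    · have := hfar j hj h
      omega
  have hcross : ∀ j ∈ S, ∀ k ∈ S, (k - i).val + r = (j - i).val + n → False := by
    intro j hj k hk h
    refine hS k hk r le_rfl (by omega) ?_
    have h1 : (((k - i).val + r : ℕ) : ZMod n) = (((j - i).val + n : ℕ) : ZMod n) := by rw [h]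
    push_cast at h1
    rw [ZMod.natCast_self, add_zero] at h1
    have h2 : k + (r : ZMod n) = j := by
      calc k + (r : ZMod n) = i + (((k - i).val : ZMod n) + r) := by rw [← add_assoc, hval]
        _ = j := by rw [h1, hval]
    rwa [h2]
  have hinj : Set.InjOn φ S := by
    intro j hj k hk hjk
    have e1 := hval j
    have e2 := hval k
    have l1 := hlt j
    have l2 := hlt k
    simp only [hφ] at hjk
    have key : (j - i).val = (k - i).val := by
      split_ifs at hjk with h1 h2 h2
      · exact hjk
      · exact (hcross j hj k hk (by have := hfar k hk h2; omega)).elim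
      · exact (hcross k hk j hj (by have := hfar j hj h1; omega)).elim
      · have := hfar k hk h2
        have := hfar j hj h1
        omega
    rw [← e1, ← e2, key]
  refine ⟨by simpa using Finset.card_le_card_of_injOn φ hmaps hinj, fun hcard t ht => ?_⟩
  have himg : S.image φ = Finset.range r :=
    Finset.eq_of_subset_of_card_le (Finset.image_subset_iff.mpr hmaps)
      (by rw [Finset.card_image_of_injOn hinj, hcard, Finset.card_range])
  have : t ∈ S.image φ := by rw [himg]; exact Finset.mem_range.mpr ht
  obtain ⟨j, hj, hjt⟩ := Finset.mem_image.mp this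
  simp only [hφ] at hjt
  split_ifs at hjt with h
  · left
    rwa [← hjt, hval]
  · right
    have h3 := hfar j hj h
    have h4 : (j - i).val + r = t + n := by omega
    have h5 : (((j - i).val + r : ℕ) : ZMod n) = ((t + n : ℕ) : ZMod n) := by rw [h4]
    push_cast at h5
    rw [ZMod.natCast_self, add_zero] at h5
    have h6 : i + (t : ZMod n) - r = j := by
      rw [← h5]
      calc i + (((j - i).val : ZMod n) + r) - r = i + ((j - i).val : ZMod n) := by ring
        _ = j := hval j
    rwa [h6]

/-- Since `i - 1` is missing, the pair condition successively excludes `i - 2, i - 3, …, i - (r -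
1)`; each pair must then be served by its forward element, so `S` is the run that starts at `i`. -/
theorem mem_of_cyclically_close {n r : ℕ} [NeZero n] (hn : 2 * r < n) {S : Finset (ZMod n)}
    (hS : ∀ i ∈ S, ∀ d : ℕ, r ≤ d → d + r ≤ n → i + d ∉ S) (hcard : S.card = r)
    {i : ZMod n} (hi : i ∈ S) (hi' : i - 1 ∉ S) {t : ℕ} (ht : t < r) : i + t ∈ S := by
  have hpair := (card_le_of_cyclically_close hn hS hi).2 hcard
  have hneg : ∀ s : ℕ, s + 1 < r → i - ((s + 1 : ℕ) : ZMod n) ∉ S := by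
    intro s
    induction s with
    | zero => intro _; simpa using hi'
    | succ s ih =>
      intro hs hmem
      rcases hpair (r - (s + 1)) (by omega) with h | h
      -- Distance `r + 1` is forbidden because `2 * r < n` is strict.
      · refine hS _ hmem (r + 1) (by omega) (by omega) ?_
        convert h using 1
        rw [Nat.cast_sub (by omega)]
        push_cast
        ring
      · refine ih (by omega) ?_
        convert h using 1
        rw [Nat.cast_sub (by omega)]
        push_cast
        ring
  rcases Nat.eq_zero_or_pos t with rfl | hpos
  · simpa using hi
  · rcases hpair t ht with h | h
    · exact h
    · refine (hneg (r - t - 1) (by omega) ?_).elim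
      convert h using 1
      rw [show r - t - 1 + 1 = r - t by omega, Nat.cast_sub ht.le]
      ring

variable {n : ℕ}

/-- The set of `r` cyclically consecutive elements that starts at position `i`. -/
def arc (σ : ZMod n ≃ Fin n) (r : ℕ) (i : ZMod n) : Finset (Fin n) :=
  (Finset.range r).image fun t : ℕ => σ (i + t)

theorem mem_arc {σ : ZMod n ≃ Fin n} {r : ℕ} {i : ZMod n} {x : Fin n} :
    x ∈ arc σ r i ↔ ∃ t < r, σ (i + t) = x := by
  simp [arc]

theorem natCast_inj_of_lt {s t : ℕ} (hs : s < n) (ht : t < n) (h : (s : ZMod n) = t) : s = t := by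
  rw [ZMod.natCast_eq_natCast_iff'] at h
  rwa [Nat.mod_eq_of_lt hs, Nat.mod_eq_of_lt ht] at h

theorem disjoint_arc {σ : ZMod n ≃ Fin n} {r d : ℕ} (h1 : r ≤ d) (h2 : d + r ≤ n) (i : ZMod n) :
    Disjoint (arc σ r i) (arc σ r (i + d)) := by
  rw [Finset.disjoint_left]
  intro x hx hx'
  obtain ⟨s, hs, rfl⟩ := mem_arc.mp hx
  obtain ⟨t, ht, h⟩ := mem_arc.mp hx'
  have h3 : ((d + t : ℕ) : ZMod n) = (s : ℕ) := by
    have := σ.injective h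
    push_cast
    exact add_left_cancel (a := i) (by rw [← add_assoc]; exact this)
  have := natCast_inj_of_lt (by omega) (by omega) h3
  omega

theorem arc_trans (σ : ZMod n ≃ Fin n) (τ : Equiv.Perm (Fin n)) (r : ℕ) (i : ZMod n) :
    arc (σ.trans τ) r i = (arc σ r i).map τ.toEmbedding := by
  ext x
  simp only [mem_arc, Finset.mem_map, Equiv.coe_trans, Function.comp_apply]
  constructor
  · rintro ⟨t, ht, rfl⟩
    exact ⟨_, ⟨t, ht, rfl⟩, rfl⟩
  · rintro ⟨_, ⟨t, ht, rfl⟩, rfl⟩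
    exact ⟨t, ht, rfl⟩

variable [NeZero n]

/-- The starting points of the arcs of a cyclic order that belong to a family. -/
def arcStarts (F : Finset (Finset (Fin n))) (r : ℕ) (σ : ZMod n ≃ Fin n) : Finset (ZMod n) :=
  Finset.univ.filter fun i => arc σ r i ∈ F

theorem mem_arcStarts {F : Finset (Finset (Fin n))} {r : ℕ} {σ : ZMod n ≃ Fin n} {i : ZMod n} :
    i ∈ arcStarts F r σ ↔ arc σ r i ∈ F := by
  simp [arcStarts]

theorem arcStarts_close {F : Finset (Finset (Fin n))} (hF : (F : Set (Finset (Fin n))).Intersecting)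
    {r : ℕ} {σ : ZMod n ≃ Fin n} : ∀ i ∈ arcStarts F r σ, ∀ d : ℕ, r ≤ d → d + r ≤ n →
      i + d ∉ arcStarts F r σ := by
  intro i hi d h1 h2 h3
  rw [mem_arcStarts] at hi h3
  exact hF (Finset.mem_coe.mpr hi) (Finset.mem_coe.mpr h3) (disjoint_arc h1 h2 i)

theorem card_arcStarts_le {F : Finset (Finset (Fin n))}
    (hF : (F : Set (Finset (Fin n))).Intersecting) {r : ℕ} (hn : 2 * r < n)
    (σ : ZMod n ≃ Fin n) : (arcStarts F r σ).card ≤ r := by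
  rcases (arcStarts F r σ).eq_empty_or_nonempty with h | ⟨i, hi⟩
  · simp [h]
  · exact (card_le_of_cyclically_close hn (arcStarts_close hF) hi).1

theorem sum_card_arcStarts (F : Finset (Finset (Fin n))) (r : ℕ) :
    ∑ σ : ZMod n ≃ Fin n, (arcStarts F r σ).card =
      ∑ f ∈ F, ∑ i : ZMod n, (Finset.univ.filter fun σ : ZMod n ≃ Fin n => arc σ r i = f).card := by
  simp only [arcStarts, Finset.card_filter]
  rw [Finset.sum_comm, Finset.sum_comm (s := F)]
  refine Finset.sum_congr rfl fun i _ => ?_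
  rw [Finset.sum_comm (s := F)]
  refine Finset.sum_congr rfl fun σ _ => ?_
  rw [Finset.sum_ite_eq]

/-- A permutation of `[n]` that carries `f` to `g` acts bijectively on the cyclic orders. Hence all
`r`-sets have the same weight in the double count. -/
theorem card_filter_arc_eq {f g : Finset (Fin n)} (h : f.card = g.card) (r : ℕ) (i : ZMod n) :
    (Finset.univ.filter fun σ : ZMod n ≃ Fin n => arc σ r i = f).card =
      (Finset.univ.filter fun σ : ZMod n ≃ Fin n => arc σ r i = g).card := by
  obtain ⟨τ, hτ⟩ : ∃ τ : Equiv.Perm (Fin n), f.map τ.toEmbedding = g := by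
    obtain ⟨e⟩ : Nonempty (f ≃ g) := ⟨Finset.equivOfCardEq h⟩
    refine ⟨e.extendSubtype, ?_⟩
    refine Finset.eq_of_subset_of_card_le ?_ (by rw [Finset.card_map, h])
    intro y hy
    obtain ⟨x, hx, rfl⟩ := Finset.mem_map.mp hy
    exact e.extendSubtype_mem x hx
  refine Finset.card_bij (fun σ _ => σ.trans τ) ?_ ?_ ?_
  · intro σ hσ
    simp only [Finset.mem_filter, Finset.mem_univ, true_and] at hσ ⊢
    rw [arc_trans, hσ, hτ]
  · intro σ _ σ' _ h
    ext z
    have := congrArg (fun e => τ.symm (e z)) h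
    simpa using congrArg Fin.val this
  · intro σ hσ
    simp only [Finset.mem_filter, Finset.mem_univ, true_and] at hσ
    refine ⟨σ.trans τ.symm, ?_, ?_⟩
    · simp only [Finset.mem_filter, Finset.mem_univ, true_and]
      rw [arc_trans, hσ, ← hτ, Finset.map_map]
      ext x
      simp
    · ext z; simp

/-- The `r`-subsets of `[n]` that contain `x`. -/
def fullStar (n r : ℕ) (x : Fin n) : Finset (Finset (Fin n)) :=
  (Finset.powersetCard r Finset.univ).filter fun e => x ∈ e

/-- The arcs through `x` are those that start at most `r - 1` steps before the position of `x`. -/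
theorem card_arcStarts_star {r : ℕ} (hr : r ≤ n) (x : Fin n) (σ : ZMod n ≃ Fin n) :
    (arcStarts (fullStar n r x) r σ).card = r := by
  have h : arcStarts (fullStar n r x) r σ =
      (Finset.range r).image fun t : ℕ => σ.symm x - (t : ZMod n) := by
    ext i
    simp only [mem_arcStarts, fullStar, Finset.mem_filter, Finset.mem_powersetCard,
      Finset.subset_univ, true_and, Finset.mem_image, Finset.mem_range, mem_arc]
    constructor
    · rintro ⟨-, t, ht, rfl⟩
      exact ⟨t, ht, by simp⟩
    · rintro ⟨t, ht, rfl⟩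
      refine ⟨?_, t, ht, by simp⟩
      rw [arc, Finset.card_image_of_injOn, Finset.card_range]
      intro s hs u hu hsu
      rw [Finset.coe_range, Set.mem_Iio] at hs hu
      exact natCast_inj_of_lt (hs.trans_le hr) (hu.trans_le hr)
        (add_left_cancel (σ.injective hsu))
  rw [h, Finset.card_image_of_injOn, Finset.card_range]
  intro s hs u hu hsu
  rw [Finset.coe_range, Set.mem_Iio] at hs hu
  exact natCast_inj_of_lt (hs.trans_le hr) (hu.trans_le hr) (sub_right_injective hsu)

/-- Equality in the Erdős–Ko–Rado bound forces equality in every cyclic order. -/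
theorem card_arcStarts_eq {r : ℕ} (hn : 2 * r < n) {F : Finset (Finset (Fin n))}
    (hF : (F : Set (Finset (Fin n))).Intersecting)
    (hsize : F ⊆ Finset.powersetCard r Finset.univ) (x : Fin n)
    (hcard : F.card = (fullStar n r x).card) (σ : ZMod n ≃ Fin n) : (arcStarts F r σ).card = r := by
  have hconst : ∀ f ∈ F, ∀ g ∈ fullStar n r x,
      (∑ i : ZMod n, (Finset.univ.filter fun σ : ZMod n ≃ Fin n => arc σ r i = f).card) =
      ∑ i : ZMod n, (Finset.univ.filter fun σ : ZMod n ≃ Fin n => arc σ r i = g).card := by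
    intro f hf g hg
    refine Finset.sum_congr rfl fun i _ => card_filter_arc_eq ?_ r i
    rw [(Finset.mem_powersetCard.mp (hsize hf)).2,
      (Finset.mem_powersetCard.mp (Finset.mem_filter.mp hg).1).2]
  have hsum : ∑ σ : ZMod n ≃ Fin n, (arcStarts F r σ).card = ∑ σ : ZMod n ≃ Fin n, r := by
    rw [← Finset.sum_congr rfl fun σ _ => card_arcStarts_star (by omega : r ≤ n) x σ,
      sum_card_arcStarts, sum_card_arcStarts]
    rcases (fullStar n r x).eq_empty_or_nonempty with h | ⟨g, hg⟩
    · rw [h, Finset.card_empty, Finset.card_eq_zero] at hcard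
      rw [h, hcard]
    · have hc : ∀ f ∈ fullStar n r x, (∑ i : ZMod n,
          (Finset.univ.filter fun σ : ZMod n ≃ Fin n => arc σ r i = f).card) =
          ∑ i : ZMod n, (Finset.univ.filter fun σ : ZMod n ≃ Fin n => arc σ r i = g).card := by
        intro f hf
        refine Finset.sum_congr rfl fun i _ => card_filter_arc_eq ?_ r i
        rw [(Finset.mem_powersetCard.mp (Finset.mem_filter.mp hf).1).2,
          (Finset.mem_powersetCard.mp (Finset.mem_filter.mp hg).1).2]
      rw [Finset.sum_congr rfl fun f hf => hconst f hf g hg, Finset.sum_congr rfl hc,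
        Finset.sum_const, Finset.sum_const, hcard]
  exact (Finset.sum_eq_sum_iff_of_le fun σ _ => card_arcStarts_le hF hn σ).mp hsum σ
    (Finset.mem_univ σ)

/-- The cyclic order given by a list of all elements. -/
noncomputable def cyclicOrderOfList (L : List (Fin n)) (hL : L.Nodup) (hlen : L.length = n) :
    ZMod n ≃ Fin n :=
  Equiv.ofBijective (fun z => L[z.val]'(by rw [hlen]; exact ZMod.val_lt z)) <| by
    rw [Fintype.bijective_iff_injective_and_card]
    refine ⟨fun y z h => ZMod.val_injective n ((hL.getElem_inj_iff).mp h), by simp [ZMod.card]⟩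

theorem arc_cyclicOrderOfList {L l₁ l₂ l₃ : List (Fin n)} (hL : L.Nodup) (hlen : L.length = n)
    (h : L = l₁ ++ l₂ ++ l₃) :
    arc (cyclicOrderOfList L hL hlen) l₂.length (l₁.length : ZMod n) = l₂.toFinset := by
  subst h
  ext x
  rw [mem_arc, List.mem_toFinset, List.mem_iff_getElem]
  have hlen' := hlen
  simp only [List.length_append] at hlen'
  have key : ∀ t (ht : t < l₂.length),
      cyclicOrderOfList _ hL hlen ((l₁.length : ZMod n) + t) = l₂[t] := by
    intro t ht
    have hv : ((l₁.length : ZMod n) + (t : ZMod n)).val = l₁.length + t := by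
      rw [← Nat.cast_add, ZMod.val_natCast_of_lt (by omega)]
    simp only [cyclicOrderOfList, Equiv.ofBijective_apply, hv]
    rw [List.getElem_append_left (by simp; omega), List.getElem_append_right (by omega)]
    simp
  constructor
  · rintro ⟨t, ht, hx⟩
    exact ⟨t, ht, by rw [← hx, key t ht]⟩
  · rintro ⟨t, ht, hx⟩
    exact ⟨t, ht, by rw [← hx, key t ht]⟩

end CyclicOrders

/-! ### Uniqueness of the extremal families. -/

section Uniqueness

variable {n r : ℕ} [NeZero n] {F : Finset (Finset (Fin n))}

/-- The first and the last arc of the run of `r` consecutive arcs overlap in one position. -/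
theorem exists_inter_eq_singleton (hr : 1 ≤ r) (hn : 2 * r < n)
    (hF : (F : Set (Finset (Fin n))).Intersecting)
    (hcard : ∀ σ, (arcStarts F r σ).card = r) :
    ∃ A ∈ F, ∃ B ∈ F, ∃ x, A ∩ B = {x} := by
  obtain ⟨σ⟩ : Nonempty (ZMod n ≃ Fin n) := ⟨Fintype.equivOfCardEq (by simp [ZMod.card])⟩
  -- If no run had a beginning, walking backwards would put all `n > r` positions into the set.
  obtain ⟨i, hi, hi'⟩ : ∃ i ∈ arcStarts F r σ, i - 1 ∉ arcStarts F r σ := by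
    by_contra! h
    obtain ⟨j, hj⟩ : (arcStarts F r σ).Nonempty := by
      rw [← Finset.card_pos, hcard]; omega
    have hall : ∀ k : ℕ, j - k ∈ arcStarts F r σ := by
      intro k
      induction k with
      | zero => simpa using hj
      | succ k ih =>
        have := h _ ih
        rwa [sub_sub, ← Nat.cast_succ] at this
    have huniv : arcStarts F r σ = Finset.univ := by
      ext z
      simp only [Finset.mem_univ, iff_true]
      have := hall (j - z).val
      rw [ZMod.natCast_zmod_val] at this
      simpa using this
    have := hcard σ
    rw [huniv, Finset.card_univ, ZMod.card] at this
    omega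
  have hlast : i + ((r - 1 : ℕ) : ZMod n) ∈ arcStarts F r σ :=
    mem_of_cyclically_close hn (arcStarts_close hF) (hcard σ) hi hi' (by omega)
  refine ⟨_, mem_arcStarts.mp hi, _, mem_arcStarts.mp hlast,
    σ (i + ((r - 1 : ℕ) : ZMod n)), ?_⟩
  ext y
  simp only [Finset.mem_inter, mem_arc, Finset.mem_singleton]
  constructor
  · rintro ⟨⟨s, hs, rfl⟩, t, ht, h⟩
    have h3 : ((r - 1 + t : ℕ) : ZMod n) = (s : ℕ) := by
      have := σ.injective h
      rw [add_assoc] at this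
      rw [Nat.cast_add]
      exact add_left_cancel this
    have := natCast_inj_of_lt (by omega) (by omega) h3
    rw [show s = r - 1 by omega]
  · rintro rfl
    exact ⟨⟨r - 1, by omega, rfl⟩, 0, by omega, by simp⟩

/-- Arrange `[n]` cyclically as `A \ C`, `(A ∩ C) \ {x}`, `x`, `(B ∩ C) \ {x}`, `B \ C`, and the
rest. Then `A` is the arc at `0`, `B` the arc at `r - 1`, and `C` an arc that starts between them.
The run of arcs from `F` begins with `A`, so it includes `C`. -/
theorem mem_of_subset_union (hn : 2 * r < n)
    (hF : (F : Set (Finset (Fin n))).Intersecting)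
    (hsize : F ⊆ Finset.powersetCard r Finset.univ)
    (hcard : ∀ σ, (arcStarts F r σ).card = r) {A B C : Finset (Fin n)} {x : Fin n}
    (hA : A ∈ F) (hB : B ∈ F) (hAB : A ∩ B = {x}) (hx : x ∈ C) (hC : C ⊆ A ∪ B)
    (hCr : C.card = r) : C ∈ F := by
  have hAr := (Finset.mem_powersetCard.mp (hsize hA)).2
  have hBr := (Finset.mem_powersetCard.mp (hsize hB)).2
  have hxAB : x ∈ A ∩ B := by rw [hAB]; exact Finset.mem_singleton_self x
  have hxA := (Finset.mem_inter.mp hxAB).1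
  have hxB := (Finset.mem_inter.mp hxAB).2
  have honly : ∀ y, y ∈ A → y ∈ B → y = x := fun y h1 h2 => by
    have : y ∈ A ∩ B := Finset.mem_inter.mpr ⟨h1, h2⟩
    rwa [hAB, Finset.mem_singleton] at this
  set a := (A \ C).toList with ha
  set c := ((A ∩ C).erase x).toList with hc
  set d := ((B ∩ C).erase x).toList with hd
  set b := (B \ C).toList with hb
  set o := (Finset.univ \ (A ∪ B)).toList with ho
  have hL : (a ++ c ++ [x] ++ d ++ b ++ o).Nodup := by
    simp only [List.nodup_append, ha, hc, hd, hb, ho, Finset.nodup_toList, List.mem_append,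
      Finset.mem_toList, Finset.mem_sdiff, Finset.mem_erase, Finset.mem_inter, List.mem_singleton,
      List.nodup_singleton, true_and, Finset.mem_univ, Finset.mem_union]
    grind
  have hset : (a ++ c ++ [x] ++ d ++ b ++ o).toFinset = Finset.univ := by
    ext y
    simp only [List.mem_toFinset, ha, hc, hd, hb, ho, List.mem_append,
      Finset.mem_toList, Finset.mem_sdiff, Finset.mem_erase, Finset.mem_inter, List.mem_singleton,
      Finset.mem_univ, Finset.mem_union]
    grind
  have hlen : (a ++ c ++ [x] ++ d ++ b ++ o).length = n := by
    rw [← List.toFinset_card_of_nodup hL, hset, Finset.card_univ, Fintype.card_fin]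
  have hsub : ∀ {l₁ l₂ l₃ : List (Fin n)} {D : Finset (Fin n)},
      a ++ c ++ [x] ++ d ++ b ++ o = l₁ ++ l₂ ++ l₃ → l₂.toFinset = D → D.card = r →
        arc (cyclicOrderOfList _ hL hlen) r (l₁.length : ZMod n) = D := by
    intro l₁ l₂ l₃ D h hD hDr
    have hnd : l₂.Nodup := by
      rw [h, List.nodup_append, List.nodup_append] at hL
      exact hL.1.2.1
    rw [← hDr, ← hD, List.toFinset_card_of_nodup hnd]
    exact arc_cyclicOrderOfList hL hlen h
  have e1 : (a ++ c ++ [x]).toFinset = A := by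
    ext y
    simp only [List.mem_toFinset, ha, hc, List.mem_append, Finset.mem_toList, Finset.mem_sdiff,
      Finset.mem_erase, Finset.mem_inter, List.mem_singleton]
    grind
  have e2 : ([x] ++ d ++ b).toFinset = B := by
    ext y
    simp only [List.mem_toFinset, hd, hb, List.mem_append, Finset.mem_toList, Finset.mem_sdiff,
      Finset.mem_erase, Finset.mem_inter, List.mem_singleton]
    grind
  have e3 : (c ++ [x] ++ d).toFinset = C := by
    ext y
    simp only [List.mem_toFinset, hc, hd, List.mem_append, Finset.mem_toList,
      Finset.mem_erase, Finset.mem_inter, List.mem_singleton]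
    have := @hC y
    rw [Finset.mem_union] at this
    grind
  have s1 := hsub (l₁ := []) (l₂ := a ++ c ++ [x]) (l₃ := d ++ b ++ o) (by simp) e1 hAr
  have s2 := hsub (l₁ := a ++ c) (l₂ := [x] ++ d ++ b) (l₃ := o) (by simp) e2 hBr
  have s3 := hsub (l₁ := a) (l₂ := c ++ [x] ++ d) (l₃ := b ++ o) (by simp) e3 hCr
  have hlenA : a.length + c.length + 1 = r := by
    rw [← hAr, ← e1, List.toFinset_card_of_nodup]
    · simp; omega
    · simp only [List.append_assoc] at hL ⊢
      rw [← List.append_assoc c, ← List.append_assoc a] at hL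
      exact (List.nodup_append.mp hL).1
  generalize cyclicOrderOfList _ hL hlen = σ at s1 s2 s3
  have m1 : (0 : ZMod n) ∈ arcStarts F r σ := by
    rw [mem_arcStarts]
    rw [List.length_nil, Nat.cast_zero] at s1
    rwa [s1]
  -- The arc at `-1` is disjoint from `B`, which starts `r` positions later.
  have m2 : (0 : ZMod n) - 1 ∉ arcStarts F r σ := by
    intro h
    refine arcStarts_close hF _ h r le_rfl (by omega) ?_
    rw [mem_arcStarts]
    have : (0 : ZMod n) - 1 + r = ((a ++ c).length : ZMod n) := by
      rw [← hlenA, List.length_append]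
      push_cast
      ring
    rwa [this, s2]
  have m3 := mem_of_cyclically_close hn (arcStarts_close hF) (hcard σ) m1 m2
    (t := a.length) (by omega)
  rw [mem_arcStarts, zero_add, s3] at m3
  exact m3

/-- If `G` misses `x` and sticks out of `A ∪ B`, it covers at most `r - 1` of the `2r - 2` other
elements of `A ∪ B`. The uncovered ones suffice to complete `x` to an `r`-set inside `A ∪ B` that
belongs to `F` and is disjoint from `G`. -/
theorem mem_or_subset_union (hn : 2 * r < n) (hr : 1 ≤ r)
    (hF : (F : Set (Finset (Fin n))).Intersecting)
    (hsize : F ⊆ Finset.powersetCard r Finset.univ)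
    (hcard : ∀ σ, (arcStarts F r σ).card = r) {A B G : Finset (Fin n)} {x : Fin n}
    (hA : A ∈ F) (hB : B ∈ F) (hAB : A ∩ B = {x}) (hG : G ∈ F) : x ∈ G ∨ G ⊆ A ∪ B := by
  by_contra! h
  obtain ⟨hxG, hGW⟩ := h
  have hAr := (Finset.mem_powersetCard.mp (hsize hA)).2
  have hBr := (Finset.mem_powersetCard.mp (hsize hB)).2
  have hGr := (Finset.mem_powersetCard.mp (hsize hG)).2
  have hxAB : x ∈ A ∩ B := by rw [hAB]; exact Finset.mem_singleton_self x
  have hW : (A ∪ B).card + 1 = 2 * r := by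
    have := Finset.card_union_add_card_inter A B
    rw [hAB, Finset.card_singleton] at this
    omega
  have hGlt : (G ∩ (A ∪ B)).card < r := by
    rw [← hGr]
    refine Finset.card_lt_card ⟨Finset.inter_subset_left, fun h => hGW ?_⟩
    exact fun y hy => (Finset.mem_inter.mp (h hy)).2
  have hle : r - 1 ≤ (((A ∪ B).erase x) \ G).card := by
    have h1 : ((A ∪ B).erase x).card = 2 * r - 2 := by
      rw [Finset.card_erase_of_mem (Finset.mem_union_left _ (Finset.mem_inter.mp hxAB).1)]
      omega
    have h2 := Finset.card_sdiff_add_card_inter ((A ∪ B).erase x) G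
    have h3 : ((A ∪ B).erase x ∩ G).card ≤ (G ∩ (A ∪ B)).card :=
      Finset.card_le_card fun y hy => by
        simp only [Finset.mem_inter, Finset.mem_erase] at hy ⊢
        exact ⟨hy.2, hy.1.2⟩
    omega
  obtain ⟨D, hD, hDr⟩ := Finset.exists_subset_card_eq hle
  have hxD : x ∉ D := fun h => by simpa using hD h
  have hCF : insert x D ∈ F := by
    refine mem_of_subset_union hn hF hsize hcard hA hB hAB (Finset.mem_insert_self x D) ?_ ?_
    · refine Finset.insert_subset (Finset.mem_union_left _ (Finset.mem_inter.mp hxAB).1) ?_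
      exact fun y hy => (Finset.mem_erase.mp (Finset.mem_sdiff.mp (hD hy)).1).2
    · rw [Finset.card_insert_of_notMem hxD]
      omega
  refine hF (Finset.mem_coe.mpr hCF) (Finset.mem_coe.mpr hG) ?_
  rw [Finset.disjoint_insert_left]
  exact ⟨hxG, Finset.disjoint_left.mpr fun y hy => (Finset.mem_sdiff.mp (hD hy)).2⟩

/-- For `2 * r < n`, an intersecting family of `r`-sets of the size of a star that has `r` arcs in every
cyclic order is fixed by some
element. -/
theorem exists_fixedBy_of_card_eq (hr : 1 ≤ r) (hn : 2 * r < n)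
    (hF : (F : Set (Finset (Fin n))).Intersecting)
    (hsize : F ⊆ Finset.powersetCard r Finset.univ)
    (hN : F.card = (n - 1).choose (r - 1)) (hcard : ∀ σ, (arcStarts F r σ).card = r) :
    ∃ x, FixedBy F x := by
  obtain ⟨A, hA, B, hB, x, hAB⟩ := exists_inter_eq_singleton hr hn hF hcard
  refine ⟨x, fun G hG => ?_⟩
  by_contra hxG
  have hcardr : ∀ H ∈ F, H.card = r := fun H hH => (Finset.mem_powersetCard.mp (hsize hH)).2
  have hxAB : x ∈ A ∩ B := by rw [hAB]; exact Finset.mem_singleton_self x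
  have hxW : x ∈ A ∪ B := Finset.mem_union_left _ (Finset.mem_inter.mp hxAB).1
  have hW : (A ∪ B).card + 1 = 2 * r := by
    have := Finset.card_union_add_card_inter A B
    rw [hAB, Finset.card_singleton, hcardr A hA, hcardr B hB] at this
    omega
  have hGW : G ⊆ A ∪ B :=
    (mem_or_subset_union hn hr hF hsize hcard hA hB hAB hG).resolve_left hxG
  have hGW' : G ⊆ (A ∪ B).erase x := fun y hy =>
    Finset.mem_erase.mpr ⟨fun h => hxG (h ▸ hy), hGW hy⟩
  have hDcard : (((A ∪ B).erase x) \ G).card = r - 2 := by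
    rw [Finset.card_sdiff_of_subset hGW', Finset.card_erase_of_mem hxW, hcardr G hG]
    omega
  have hr2 : 2 ≤ r := by
    have := Finset.card_le_card hGW'
    rw [Finset.card_erase_of_mem hxW, hcardr G hG] at this
    omega
  -- A member `G` that misses `x` confines the whole family to the `2r - 1` points of `A ∪ B`, which
  -- leaves too little room.
  have hall : ∀ H ∈ F, H ⊆ A ∪ B := by
    intro H hH
    by_contra hHW
    have hxH : x ∈ H :=
      (mem_or_subset_union hn hr hF hsize hcard hA hB hAB hH).resolve_right hHW
    have hGH : insert x G ⊆ H := by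
      refine Finset.insert_subset hxH fun g hg => ?_
      -- `C` is a member of `F` with `C ∩ G = {g}`, so the dichotomy applies again, now with centre
      -- `g`. A set `H` not inside `A ∪ B` thus contains every `g ∈ G` as well as `x`, which is `r +
      -- 1` elements.
      set C := insert x (insert g (((A ∪ B).erase x) \ G)) with hCdef
      have hgW := hGW hg
      have hgx : x ≠ g := fun h => hxG (h ▸ hg)
      have hCW : C ⊆ A ∪ B := by
        refine Finset.insert_subset hxW (Finset.insert_subset hgW fun y hy => ?_)
        exact (Finset.mem_erase.mp (Finset.mem_sdiff.mp hy).1).2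
      have hCF : C ∈ F := by
        refine mem_of_subset_union hn hF hsize hcard hA hB hAB (Finset.mem_insert_self x _) hCW ?_
        rw [hCdef, Finset.card_insert_of_notMem, Finset.card_insert_of_notMem, hDcard]
        · omega
        · simp [hg]
        · simp [hgx]
      have hCG : C ∩ G = {g} := by
        ext y
        simp only [hCdef, Finset.mem_inter, Finset.mem_insert, Finset.mem_sdiff,
          Finset.mem_singleton]
        grind
      refine (mem_or_subset_union hn hr hF hsize hcard hCF hG hCG hH).resolve_right fun h => hHW ?_
      exact h.trans (Finset.union_subset hCW hGW)
    have := Finset.card_le_card hGH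
    rw [Finset.card_insert_of_notMem hxG, hcardr G hG, hcardr H hH] at this
    omega
  have hsmall : F ⊆ Finset.powersetCard r (A ∪ B) := fun H hH =>
    Finset.mem_powersetCard.mpr ⟨hall H hH, hcardr H hH⟩
  have h1 := Finset.card_le_card hsmall
  obtain ⟨s, rfl⟩ : ∃ s, r = s + 2 := ⟨r - 2, by omega⟩
  rw [Finset.card_powersetCard, hN, show (A ∪ B).card = 2 * s + 3 by omega,
    show s + 2 - 1 = s + 1 by omega] at h1
  -- With `r = s + 2`: `(2r-1).choose r = (2r-1).choose (r-1) < (2r).choose (r-1) ≤ (n-1).choose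
  -- (r-1)`.
  have h2 : (2 * s + 3).choose (s + 2) = (2 * s + 3).choose (s + 1) :=
    Nat.choose_symm_of_eq_add (by omega)
  have h3 : (2 * s + 4).choose (s + 1) ≤ (n - 1).choose (s + 1) :=
    Nat.choose_le_choose _ (by omega)
  have h4 : (2 * s + 4).choose (s + 1) = (2 * s + 3).choose s + (2 * s + 3).choose (s + 1) :=
    Nat.choose_succ_succ _ _
  have h5 : 0 < (2 * s + 3).choose s := Nat.choose_pos (by omega)
  omega

end Uniqueness

/-! ### Counting admissible sets and transversals. -/

section Counting

variable {n r : ℕ}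

theorem mem_fullStar {x : Fin n} {e : Finset (Fin n)} :
    e ∈ fullStar n r x ↔ e.card = r ∧ x ∈ e := by
  simp [fullStar]

theorem mem_admissible {F : Finset (Finset (Fin n))} {e : Finset (Fin n)} :
    e ∈ admissible n r F ↔ e.card = r ∧ e ∉ F ∧ ∀ f ∈ F, (e ∩ f).Nonempty := by
  simp [admissible]

/-- The `r`-sets that contain `U` and avoid `W`. -/
def setsBetween (r : ℕ) (U W : Finset (Fin n)) : Finset (Finset (Fin n)) :=
  (Finset.powersetCard r Wᶜ).filter (U ⊆ ·)

theorem mem_setsBetween {U W e : Finset (Fin n)} :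
    e ∈ setsBetween r U W ↔ e.card = r ∧ U ⊆ e ∧ Disjoint e W := by
  rw [setsBetween, Finset.mem_filter, Finset.mem_powersetCard, Finset.subset_compl_iff_disjoint_right]
  tauto

theorem card_setsBetween {U W : Finset (Fin n)} (h : Disjoint U W) (hU : U.card ≤ r) :
    (setsBetween r U W).card = (n - W.card - U.card).choose (r - U.card) := by
  rw [setsBetween, Finset.card_filter_powersetCard_subset _ _ _
    (Finset.subset_compl_iff_disjoint_right.mpr h) hU, Finset.card_compl, Fintype.card_fin]

theorem card_fullStar (hr : 1 ≤ r) (x : Fin n) :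
    (fullStar n r x).card = (n - 1).choose (r - 1) := by
  have h : fullStar n r x = setsBetween r {x} ∅ := by
    ext e
    simp [mem_fullStar, mem_setsBetween]
  rw [h, card_setsBetween (by simp) (by simpa)]
  simp

/-- The `r`-sets that avoid `x` and meet every member of `F`. -/
def transversals (r : ℕ) (x : Fin n) (F : Finset (Finset (Fin n))) : Finset (Finset (Fin n)) :=
  (Finset.powersetCard r Finset.univ).filter fun f => x ∉ f ∧ ∀ e ∈ F, (f ∩ e).Nonempty

theorem mem_transversals {x : Fin n} {F : Finset (Finset (Fin n))} {f : Finset (Fin n)} :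
    f ∈ transversals r x F ↔ f.card = r ∧ x ∉ f ∧ ∀ e ∈ F, (f ∩ e).Nonempty := by
  simp [transversals]

theorem fixedBy_of_subset_fullStar {x : Fin n} {F : Finset (Finset (Fin n))}
    (hF : F ⊆ fullStar n r x) : FixedBy F x := fun _ he => (mem_fullStar.mp (hF he)).2

theorem disjoint_fullStar_transversals (x : Fin n) (F : Finset (Finset (Fin n))) :
    Disjoint (fullStar n r x \ F) (transversals r x F) := by
  rw [Finset.disjoint_left]
  intro e he he'
  exact (mem_transversals.mp he').2.1 (mem_fullStar.mp (Finset.mem_sdiff.mp he).1).2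

theorem admissible_eq_disjUnion {x : Fin n} {F : Finset (Finset (Fin n))}
    (hF : F ⊆ fullStar n r x) : admissible n r F =
      (fullStar n r x \ F).disjUnion (transversals r x F) (disjoint_fullStar_transversals x F) := by
  ext e
  rw [Finset.mem_disjUnion, mem_admissible, Finset.mem_sdiff, mem_fullStar, mem_transversals]
  constructor
  · rintro ⟨h1, h2, h3⟩
    by_cases hx : x ∈ e
    · exact Or.inl ⟨⟨h1, hx⟩, h2⟩
    · exact Or.inr ⟨h1, hx, h3⟩
  · rintro (⟨⟨h1, hx⟩, h2⟩ | ⟨h1, hx, h3⟩)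
    · exact ⟨h1, h2, fun f hf =>
        ⟨x, Finset.mem_inter.mpr ⟨hx, fixedBy_of_subset_fullStar hF f hf⟩⟩⟩
    · exact ⟨h1, fun h => hx (fixedBy_of_subset_fullStar hF e h), h3⟩

theorem card_admissible_of_subset_fullStar {x : Fin n} {F : Finset (Finset (Fin n))}
    (hF : F ⊆ fullStar n r x) : (admissible n r F).card =
      (fullStar n r x \ F).card + (transversals r x F).card := by
  rw [admissible_eq_disjUnion hF, Finset.card_disjUnion]

theorem sum_admissible_of_subset_fullStar {x : Fin n} {F : Finset (Finset (Fin n))}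
    (hF : F ⊆ fullStar n r x) (g : Finset (Fin n) → ℝ) : ∑ e ∈ admissible n r F, g e =
      ∑ e ∈ fullStar n r x \ F, g e + ∑ e ∈ transversals r x F, g e := by
  rw [admissible_eq_disjUnion hF, Finset.sum_disjUnion]

/-- None of the `(n - 1 - r).choose (r - 1)` sets that contain `x` and are disjoint from `f` can be
in `F`, because `f` meets all of `F`. They are all still available, and choosing any of them
eliminates `f`. -/
theorem card_filter_meets_add_le {x : Fin n} {F : Finset (Finset (Fin n))} (hr : 1 ≤ r)
    {f : Finset (Fin n)} (hf : f ∈ transversals r x F) :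
    ((fullStar n r x \ F).filter fun e => (f ∩ e).Nonempty).card + (n - 1 - r).choose (r - 1) ≤
      (fullStar n r x \ F).card := by
  obtain ⟨hfr, hxf, hfF⟩ := mem_transversals.mp hf
  have h1 : (setsBetween r {x} f).card = (n - 1 - r).choose (r - 1) := by
    rw [card_setsBetween (by simpa) (by simpa), hfr, Finset.card_singleton, Nat.sub_right_comm]
  rw [← h1, ← Finset.card_union_of_disjoint]
  · refine Finset.card_le_card (Finset.union_subset (Finset.filter_subset _ _) fun e he => ?_)
    obtain ⟨her, hxe, hef⟩ := mem_setsBetween.mp he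
    refine Finset.mem_sdiff.mpr ⟨mem_fullStar.mpr ⟨her, hxe (Finset.mem_singleton_self x)⟩,
      fun heF => ?_⟩
    exact (hfF e heF).ne_empty (Finset.disjoint_iff_inter_eq_empty.mp hef.symm)
  · rw [Finset.disjoint_left]
    intro e he he'
    exact (Finset.mem_filter.mp he).2.ne_empty
      (Finset.disjoint_iff_inter_eq_empty.mp (mem_setsBetween.mp he').2.2.symm)

/-- Double counting of the pairs of a star set and a transversal that survives it. This is the
expected loss of transversals in a step that stays in the star. -/
theorem sum_card_transversals_insert_add_le {x : Fin n} {F : Finset (Finset (Fin n))}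
    (hr : 1 ≤ r) :
    ∑ e ∈ fullStar n r x \ F, (transversals r x (insert e F)).card +
      (transversals r x F).card * (n - 1 - r).choose (r - 1) ≤
      (transversals r x F).card * (fullStar n r x \ F).card := by
  have h : ∑ e ∈ fullStar n r x \ F, (transversals r x (insert e F)).card =
      ∑ f ∈ transversals r x F,
        ((fullStar n r x \ F).filter fun e => (f ∩ e).Nonempty).card := by
    have : ∀ e, transversals r x (insert e F) =
        (transversals r x F).filter fun f => (f ∩ e).Nonempty := by
      intro e
      ext f
      simp only [Finset.mem_filter, mem_transversals, Finset.forall_mem_insert]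
      tauto
    simp only [this, Finset.card_filter]
    rw [Finset.sum_comm]
  rw [h, ← smul_eq_mul, ← Finset.sum_const, ← Finset.sum_add_distrib, ← smul_eq_mul,
    ← Finset.sum_const]
  exact Finset.sum_le_sum fun f hf => card_filter_meets_add_le hr hf

/-- The `r`-sets that meet `e₁ ∪ e₂` in exactly one element of `e₁ \ e₂` and one of `e₂ \ e₁`. -/
def crossingSets (r : ℕ) (e₁ e₂ : Finset (Fin n)) : Finset (Finset (Fin n)) :=
  ((e₁ \ e₂) ×ˢ (e₂ \ e₁)).biUnion fun p => setsBetween r {p.1, p.2} ((e₁ ∪ e₂) \ {p.1, p.2})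

/-- The pair of elements can be read off the set, so the union is disjoint; the other `r - 2`
elements lie outside `e₁ ∪ e₂`, which has `2r - |e₁ ∩ e₂|` elements. -/
theorem card_crossingSets (hr : 2 ≤ r) {e₁ e₂ : Finset (Fin n)} (h1 : e₁.card = r)
    (h2 : e₂.card = r) : (crossingSets r e₁ e₂).card =
      (r - (e₁ ∩ e₂).card) ^ 2 * (n - (2 * r - (e₁ ∩ e₂).card)).choose (r - 2) := by
  have hk : (e₁ ∩ e₂).card ≤ r := h1 ▸ Finset.card_le_card Finset.inter_subset_left
  rw [crossingSets, Finset.card_biUnion]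
  · rw [Finset.sum_congr rfl (g := fun _ => (n - (2 * r - (e₁ ∩ e₂).card)).choose (r - 2)),
      Finset.sum_const, smul_eq_mul, Finset.card_product]
    · have a1 := Finset.card_sdiff_add_card_inter e₁ e₂
      have a2 := Finset.card_sdiff_add_card_inter e₂ e₁
      rw [Finset.inter_comm e₂] at a2
      rw [show (e₁ \ e₂).card = r - (e₁ ∩ e₂).card by omega,
        show (e₂ \ e₁).card = r - (e₁ ∩ e₂).card by omega, sq]
    · rintro ⟨y, z⟩ hyz
      simp only [Finset.mem_product, Finset.mem_sdiff] at hyz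
      have hne : y ≠ z := fun h => hyz.2.2 (h ▸ hyz.1.1)
      have hsub : ({y, z} : Finset (Fin n)) ⊆ e₁ ∪ e₂ := by
        intro w hw
        simp only [Finset.mem_insert, Finset.mem_singleton] at hw
        rcases hw with rfl | rfl
        · exact Finset.mem_union_left _ hyz.1.1
        · exact Finset.mem_union_right _ hyz.2.1
      have hU : (e₁ ∪ e₂).card = 2 * r - (e₁ ∩ e₂).card := by
        have := Finset.card_union_add_card_inter e₁ e₂
        omega
      have hge := Finset.card_le_card hsub
      rw [Finset.card_pair hne] at hge
      rw [card_setsBetween Finset.disjoint_sdiff (by rw [Finset.card_pair hne]; exact hr),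
        Finset.card_sdiff_of_subset hsub, Finset.card_pair hne, hU, Nat.sub_sub]
      congr 2
      omega
  · rintro ⟨y, z⟩ hyz ⟨y', z'⟩ hyz' hne
    rw [Function.onFun, Finset.disjoint_left]
    intro f hf hf'
    simp only [Finset.coe_product, Set.mem_prod, Finset.mem_coe, Finset.mem_sdiff] at hyz hyz'
    obtain ⟨-, a, b⟩ := mem_setsBetween.mp hf
    obtain ⟨-, a', -⟩ := mem_setsBetween.mp hf'
    have key : ∀ w ∈ e₁ ∪ e₂, w ∈ f → w = y ∨ w = z := by
      intro w hw hwf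
      by_contra hcon
      refine Finset.disjoint_left.mp b hwf (Finset.mem_sdiff.mpr ⟨hw, ?_⟩)
      simpa using hcon
    have hy := key y' (Finset.mem_union_left _ hyz'.1.1) (a' (by simp))
    have hz := key z' (Finset.mem_union_right _ hyz'.2.1) (a' (by simp))
    have hy' : y' = y := hy.resolve_right fun h => hyz.2.2 (h ▸ hyz'.1.1)
    have hz' : z' = z := hz.resolve_left fun h => hyz.1.2 (h ▸ hyz'.2.1)
    exact hne (by rw [hy', hz'])

theorem mem_crossingSets {e₁ e₂ f : Finset (Fin n)} (hf : f ∈ crossingSets r e₁ e₂) :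
    f.card = r ∧ (f ∩ e₁).Nonempty ∧ (f ∩ e₂).Nonempty ∧ Disjoint f (e₁ ∩ e₂) := by
  obtain ⟨⟨y, z⟩, hyz, hf⟩ := Finset.mem_biUnion.mp hf
  simp only [Finset.mem_product, Finset.mem_sdiff] at hyz
  obtain ⟨a, b, c⟩ := mem_setsBetween.mp hf
  refine ⟨a, ⟨y, Finset.mem_inter.mpr ⟨b (by simp), hyz.1.1⟩⟩,
    ⟨z, Finset.mem_inter.mpr ⟨b (by simp), hyz.2.1⟩⟩, c.mono_right fun w hw => ?_⟩
  simp only [Finset.mem_inter, Finset.mem_sdiff, Finset.mem_union, Finset.mem_insert,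
    Finset.mem_singleton] at hw ⊢
  refine ⟨Or.inl hw.1, ?_⟩
  rintro (rfl | rfl)
  · exact hyz.1.2 hw.2
  · exact hyz.2.2 hw.1

theorem crossingSets_subset_admissible {e₁ e₂ : Finset (Fin n)} (h : (e₁ ∩ e₂).Nonempty) :
    crossingSets r e₁ e₂ ⊆ admissible n r {e₂, e₁} := by
  intro f hf
  obtain ⟨a, b, c, d⟩ := mem_crossingSets hf
  obtain ⟨x, hx⟩ := h
  refine mem_admissible.mpr ⟨a, ?_, by simp [b, c]⟩
  have hxf : x ∉ f := fun h => Finset.disjoint_left.mp d h hx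
  rw [Finset.mem_inter] at hx
  simp only [Finset.mem_insert, Finset.mem_singleton]
  rintro (rfl | rfl)
  · exact hxf hx.2
  · exact hxf hx.1

theorem crossingSets_subset_transversals {e₁ e₂ : Finset (Fin n)} {x : Fin n}
    (hx : x ∈ e₁ ∩ e₂) : crossingSets r e₁ e₂ ⊆ transversals r x {e₂, e₁} := by
  intro f hf
  obtain ⟨a, b, c, d⟩ := mem_crossingSets hf
  exact mem_transversals.mpr ⟨a, fun h => Finset.disjoint_left.mp d h hx, by simp [b, c]⟩

theorem card_transversals_pair_le (hr : 2 ≤ r) {e₁ e₂ : Finset (Fin n)} (h1 : e₁.card = r)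
    (h2 : e₂.card = r) {x : Fin n} (hx : e₁ ∩ e₂ = {x}) :
    (transversals r x {e₂, e₁}).card ≤ (r - 1) ^ 2 * (n - 2).choose (r - 2) := by
  have hxe : x ∈ e₁ ∩ e₂ := by rw [hx]; exact Finset.mem_singleton_self x
  rw [Finset.mem_inter] at hxe
  have hsub : transversals r x {e₂, e₁} ⊆
      ((e₁.erase x) ×ˢ (e₂.erase x)).biUnion fun p => setsBetween r {p.1, p.2} ∅ := by
    intro f hf
    obtain ⟨a, b, c⟩ := mem_transversals.mp hf
    simp only [Finset.forall_mem_insert, Finset.mem_singleton, forall_eq] at c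
    obtain ⟨⟨z, hz⟩, ⟨y, hy⟩⟩ := c
    rw [Finset.mem_inter] at hy hz
    refine Finset.mem_biUnion.mpr ⟨(y, z), ?_, mem_setsBetween.mpr ⟨a, ?_, by simp⟩⟩
    · simp only [Finset.mem_product, Finset.mem_erase]
      exact ⟨⟨fun h => b (h ▸ hy.1), hy.2⟩, ⟨fun h => b (h ▸ hz.1), hz.2⟩⟩
    · intro w hw
      simp only [Finset.mem_insert, Finset.mem_singleton] at hw
      rcases hw with rfl | rfl
      exacts [hy.1, hz.1]
  refine (Finset.card_le_card hsub).trans ((Finset.card_biUnion_le_card_mul _ _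
    ((n - 2).choose (r - 2)) ?_).trans ?_)
  · rintro ⟨y, z⟩ hyz
    simp only [Finset.mem_product, Finset.mem_erase] at hyz
    have hne : y ≠ z := by
      rintro rfl
      have : y ∈ e₁ ∩ e₂ := Finset.mem_inter.mpr ⟨hyz.1.2, hyz.2.2⟩
      rw [hx, Finset.mem_singleton] at this
      exact hyz.1.1 this
    rw [card_setsBetween (by simp) (by rw [Finset.card_pair hne]; exact hr),
      Finset.card_pair hne]
    simp
  · rw [Finset.card_product, Finset.card_erase_of_mem hxe.1, Finset.card_erase_of_mem hxe.2, h1, h2,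
      sq]

/-- Counts only the sets that meet `e₁` in exactly one element; `2 ≤ r` keeps `e₁` itself out of
this count. -/
theorem card_admissible_singleton_ge (hr : 2 ≤ r) {e₁ : Finset (Fin n)} (h1 : e₁.card = r) :
    r * (n - r).choose (r - 1) ≤ (admissible n r {e₁}).card := by
  have hcard : (e₁.biUnion fun y => setsBetween r {y} (e₁.erase y)).card =
      r * (n - r).choose (r - 1) := by
    rw [Finset.card_biUnion, Finset.sum_congr rfl (g := fun _ => (n - r).choose (r - 1)),
      Finset.sum_const, smul_eq_mul, h1]
    · intro y hy
      rw [card_setsBetween (by simp) (by simp; omega), Finset.card_erase_of_mem hy, h1,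
        Finset.card_singleton, Nat.sub_sub, Nat.sub_add_cancel (by omega)]
    · intro y hy z hz hne
      rw [Function.onFun, Finset.disjoint_left]
      intro f hf hf'
      have hzf := (mem_setsBetween.mp hf').2.1 (Finset.mem_singleton_self z)
      exact Finset.disjoint_left.mp (mem_setsBetween.mp hf).2.2 hzf
        (Finset.mem_erase.mpr ⟨hne.symm, hz⟩)
  rw [← hcard]
  refine Finset.card_le_card fun f hf => ?_
  obtain ⟨y, hy, hf⟩ := Finset.mem_biUnion.mp hf
  obtain ⟨a, b, c⟩ := mem_setsBetween.mp hf
  have hyf := b (Finset.mem_singleton_self y)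
  refine mem_admissible.mpr ⟨a, ?_, ?_⟩
  · rw [Finset.mem_singleton]
    rintro rfl
    obtain ⟨z, hz⟩ : (f.erase y).Nonempty := by
      rw [← Finset.card_pos, Finset.card_erase_of_mem hy]
      omega
    exact Finset.disjoint_left.mp c (Finset.mem_erase.mp hz).2 hz
  · intro g hg
    rw [Finset.mem_singleton.mp hg]
    exact ⟨y, Finset.mem_inter.mpr ⟨hyf, hy⟩⟩

/-- Together with the lower bound for the number of choices, this controls the mean size of the
intersection of the first two sets. -/
theorem sum_card_inter_le (hr : 1 ≤ r) {e₁ : Finset (Fin n)} (h1 : e₁.card = r) :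
    ∑ e ∈ admissible n r {e₁}, (e₁ ∩ e).card ≤ r * (n - 1).choose (r - 1) := by
  calc ∑ e ∈ admissible n r {e₁}, (e₁ ∩ e).card
      ≤ ∑ e ∈ Finset.powersetCard r Finset.univ, (e₁ ∩ e).card :=
        Finset.sum_le_sum_of_subset (Finset.filter_subset _ _)
    _ = ∑ e ∈ Finset.powersetCard r Finset.univ, ∑ y ∈ e₁, if y ∈ e then 1 else 0 := by
        refine Finset.sum_congr rfl fun e _ => ?_
        rw [← Finset.card_filter, Finset.filter_mem_eq_inter]
    _ = ∑ y ∈ e₁, (fullStar n r y).card := by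
        rw [Finset.sum_comm]
        simp only [fullStar, Finset.card_filter]
    _ = _ := by
        rw [Finset.sum_congr rfl fun y _ => card_fullStar hr y, Finset.sum_const, smul_eq_mul, h1]

/-- An `r`-set that is not admissible is a member of `F` or is disjoint from one. -/
theorem card_admissible_ge (F : Finset (Finset (Fin n))) (hF : ∀ f ∈ F, f.card = r) :
    n.choose r ≤ (admissible n r F).card + F.card * ((n - r).choose r + 1) := by
  have hsub : Finset.powersetCard r Finset.univ ⊆
      admissible n r F ∪ F.biUnion fun f => insert f (Finset.powersetCard r fᶜ) := by
    intro e he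
    rw [Finset.mem_union, Finset.mem_biUnion, mem_admissible]
    have her := (Finset.mem_powersetCard.mp he).2
    by_cases h : e ∉ F ∧ ∀ f ∈ F, (e ∩ f).Nonempty
    · exact Or.inl ⟨her, h⟩
    · right
      by_cases heF : e ∈ F
      · exact ⟨e, heF, Finset.mem_insert_self _ _⟩
      · obtain ⟨f, hf, hfe⟩ : ∃ f ∈ F, ¬ (e ∩ f).Nonempty := by
          by_contra! hcon
          exact h ⟨heF, hcon⟩
        refine ⟨f, hf, Finset.mem_insert_of_mem (Finset.mem_powersetCard.mpr ⟨?_, her⟩)⟩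
        rw [Finset.subset_compl_iff_disjoint_right, Finset.disjoint_iff_inter_eq_empty]
        exact Finset.not_nonempty_iff_eq_empty.mp hfe
  have h := (Finset.card_le_card hsub).trans (Finset.card_union_le _ _)
  rw [Finset.card_powersetCard, Finset.card_univ, Fintype.card_fin] at h
  refine h.trans (Nat.add_le_add_left ?_ _)
  refine Finset.card_biUnion_le_card_mul _ _ _ fun f hf => ?_
  refine (Finset.card_insert_le _ _).trans ?_
  rw [Finset.card_powersetCard, Finset.card_compl, Fintype.card_fin, hF f hf]

end Counting

/-! ### The size criterion and bounds on the probability for fixed `n` and `r`. -/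

section Bounds

variable {n r : ℕ}

theorem mem_ekrEvent_iff (hr : 1 ≤ r) (hn : 2 * r < n) {F : Finset (Finset (Fin n))}
    (hF : F ∈ (outputLaw n r).support) : F ∈ ekrEvent n r ↔ ∃ x : Fin n, FixedBy F x := by
  have : NeZero n := ⟨by omega⟩
  have hsize := (familyLaw_support n r _ F hF).1
  have hint := familyLaw_support_intersecting hr _ F hF
  constructor
  · intro h
    refine exists_fixedBy_of_card_eq hr hn hint hsize h fun σ => ?_
    refine card_arcStarts_eq hn hint hsize 0 ?_ σ
    rw [card_fullStar hr]
    exact h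
  · rintro ⟨x, hx⟩
    have hsub : F ⊆ fullStar n r x := fun e he =>
      mem_fullStar.mpr ⟨(Finset.mem_powersetCard.mp (hsize he)).2, hx e he⟩
    have hadm := card_admissible_of_subset_fullStar hsub
    rw [admissible_eq_empty_of_mem_support n r F hF, Finset.card_empty] at hadm
    have hsub' : fullStar n r x ⊆ F := by
      rw [← Finset.sdiff_eq_empty_iff_subset, ← Finset.card_eq_zero]
      omega
    have heq := Finset.Subset.antisymm hsub hsub'
    show F.card = _
    rw [heq, card_fullStar hr]

theorem probEKR_eq (hr : 1 ≤ r) (hn : 2 * r < n) :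
    probEKR n r = (stepMean n r)^[n.choose r] commonInd ∅ := by
  rw [← mean_familyLaw]
  refine toReal_toOuterMeasure_eq_mean _ _ _ (fun F hF h => ?_) fun F hF h => ?_
  · rw [commonInd, if_pos ((mem_ekrEvent_iff hr hn hF).mp h)]
  · rw [commonInd, if_neg fun h' => h ((mem_ekrEvent_iff hr hn hF).mpr h')]

theorem probEKR_nonneg : 0 ≤ probEKR n r := ENNReal.toReal_nonneg

theorem probEKR_le_iterate (hr : 1 ≤ r) (hn : 2 * r < n) {m : ℕ} (hm : m ≤ n.choose r) :
    probEKR n r ≤ (stepMean n r)^[m] commonInd ∅ := by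
  rw [probEKR_eq hr hn]
  exact iterate_stepMean_commonInd_le hm ∅

theorem le_choose_of_pos_of_lt (hr : 1 ≤ r) (hn : r < n) : n ≤ n.choose r := by
  induction n generalizing r with
  | zero => omega
  | succ n ih =>
    rcases Nat.lt_or_ge r n with h | h
    · obtain ⟨s, rfl⟩ : ∃ s, r = s + 1 := ⟨r - 1, by omega⟩
      have h1 := ih hr h
      have h2 : 0 < n.choose s := Nat.choose_pos (by omega)
      rw [Nat.choose_succ_succ]
      show n + 1 ≤ n.choose s + n.choose (s + 1)
      omega
    · obtain rfl : r = n := by omega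
      rw [Nat.choose_succ_self_right]

theorem probEKR_le_one (hr : 1 ≤ r) (hn : 2 * r < n) : probEKR n r ≤ 1 :=
  (probEKR_le_iterate hr hn (Nat.zero_le _)).trans (commonInd_le_one _)

theorem admissible_empty_nonempty (hn : r ≤ n) : (admissible n r ∅).Nonempty := by
  rw [← Finset.card_pos]
  simpa [admissible] using Nat.choose_pos hn

/-- A bound on a function of the first two sets that is affine in the size of their intersection
bounds its expectation. -/
theorem iterate_two_stepMean_le (hr : 2 ≤ r) (hn : 2 * r < n)
    {h : Finset (Finset (Fin n)) → ℝ} {α β : ℝ} (hβ : 0 ≤ β)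
    (hh : ∀ e₁ e₂ : Finset (Fin n), e₁.card = r → e₂.card = r → e₁ ≠ e₂ → (e₁ ∩ e₂).Nonempty →
      h {e₂, e₁} ≤ α + β * (e₁ ∩ e₂).card) :
    (stepMean n r)^[2] h ∅ ≤
      α + β * (((n - 1).choose (r - 1) : ℝ) / (n - r).choose (r - 1)) := by
  refine stepMean_le_of_forall (admissible_empty_nonempty (by omega)) fun e₁ he₁ => ?_
  have h1 := (mem_admissible.mp he₁).1
  rw [insert_empty_eq]
  have hC : 0 < (n - r).choose (r - 1) := Nat.choose_pos (by omega)
  have hge := card_admissible_singleton_ge hr h1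
  have hpos : 0 < (admissible n r {e₁}).card := lt_of_lt_of_le (by positivity) hge
  have hsum := sum_card_inter_le (by omega) h1
  rw [stepMean_of_nonempty (Finset.card_pos.mp hpos)]
  have hbound : ∑ e ∈ admissible n r {e₁}, h {e, e₁} ≤
      α * (admissible n r {e₁}).card + β * (r * (n - 1).choose (r - 1) : ℕ) := by
    calc ∑ e ∈ admissible n r {e₁}, h {e, e₁}
        ≤ ∑ e ∈ admissible n r {e₁}, (α + β * (e₁ ∩ e).card) := by
          refine Finset.sum_le_sum fun e he => ?_
          obtain ⟨a, b, c⟩ := mem_admissible.mp he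
          refine hh e₁ e h1 a (fun h => b (by simp [h])) ?_
          rw [Finset.inter_comm]
          exact c e₁ (Finset.mem_singleton_self _)
      _ = α * (admissible n r {e₁}).card +
          β * (∑ e ∈ admissible n r {e₁}, (e₁ ∩ e).card : ℕ) := by
          rw [Finset.sum_add_distrib, Finset.sum_const, nsmul_eq_mul, ← Finset.mul_sum]
          push_cast
          ring
      _ ≤ _ := by
          gcongr
  have hr0 : (0 : ℝ) < r := by exact_mod_cast (by omega : 0 < r)
  have hpos' : (0 : ℝ) < (admissible n r {e₁}).card := by exact_mod_cast hpos
  have hC' : (0 : ℝ) < (n - r).choose (r - 1) := by exact_mod_cast hC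
  have hge' : (r : ℝ) * (n - r).choose (r - 1) ≤ (admissible n r {e₁}).card := by
    exact_mod_cast hge
  calc _ ≤ (α * (admissible n r {e₁}).card + β * (r * (n - 1).choose (r - 1) : ℕ)) /
        (admissible n r {e₁}).card := by gcongr
    _ = α + β * ((r * (n - 1).choose (r - 1) : ℕ) / (admissible n r {e₁}).card) := by
        field_simp
    _ ≤ α + β * ((r * (n - 1).choose (r - 1) : ℕ) / (r * (n - r).choose (r - 1))) := by
        gcongr
    _ = _ := by
        push_cast
        rw [mul_div_mul_left _ _ hr0.ne']

/-! ### The probability of leaving a star. -/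

section Escape

variable {x : Fin n} {F : Finset (Finset (Fin n))}

theorem insert_subset_fullStar (hF : F ⊆ fullStar n r x) {e : Finset (Fin n)}
    (he : e ∈ fullStar n r x \ F) : insert e F ⊆ fullStar n r x :=
  Finset.insert_subset (Finset.mem_sdiff.mp he).1 hF

/-- With `T` transversals, `M` remaining star sets and `Z = (n - 1 - r).choose (r - 1)`, leaving the
star now costs at most `T`, and staying costs at most `(T M - T Z) / Z`. The two terms `T` cancel.
-/
theorem sum_admissible_le (hr : 1 ≤ r) (hn : 2 * r < n) (hF : F ⊆ fullStar n r x)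
    {h : Finset (Finset (Fin n)) → ℝ} (h1 : ∀ G, h G ≤ 1)
    (hh : ∀ G ⊆ fullStar n r x,
      h G ≤ (transversals r x G).card / (n - 1 - r).choose (r - 1)) :
    ∑ e ∈ admissible n r F, h (insert e F) ≤ (transversals r x F).card *
      ((fullStar n r x \ F).card / (n - 1 - r).choose (r - 1) : ℝ) := by
  have hZ : (0 : ℝ) < (n - 1 - r).choose (r - 1) := by
    exact_mod_cast Nat.choose_pos (by omega)
  rw [sum_admissible_of_subset_fullStar hF]
  have a1 : ∑ e ∈ transversals r x F, h (insert e F) ≤ (transversals r x F).card := by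
    calc _ ≤ ∑ e ∈ transversals r x F, (1 : ℝ) := Finset.sum_le_sum fun e _ => h1 _
      _ = _ := by simp
  have a2 : ∑ e ∈ fullStar n r x \ F, h (insert e F) ≤
      (∑ e ∈ fullStar n r x \ F, (transversals r x (insert e F)).card : ℕ) /
        ((n - 1 - r).choose (r - 1) : ℝ) := by
    push_cast
    rw [Finset.sum_div]
    exact Finset.sum_le_sum fun e he => hh _ (insert_subset_fullStar hF he)
  have a3 : ((∑ e ∈ fullStar n r x \ F, (transversals r x (insert e F)).card : ℕ) : ℝ) +
      (transversals r x F).card * (n - 1 - r).choose (r - 1) ≤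
      (transversals r x F).card * (fullStar n r x \ F).card := by
    exact_mod_cast sum_card_transversals_insert_add_le (x := x) (F := F) hr
  calc _ ≤ (∑ e ∈ fullStar n r x \ F, (transversals r x (insert e F)).card : ℕ) /
        ((n - 1 - r).choose (r - 1) : ℝ) + (transversals r x F).card := add_le_add a2 a1
    _ = ((∑ e ∈ fullStar n r x \ F, (transversals r x (insert e F)).card : ℕ) +
        (transversals r x F).card * (n - 1 - r).choose (r - 1)) /
        ((n - 1 - r).choose (r - 1) : ℝ) := by field_simp
    _ ≤ _ := by
        rw [← mul_div_assoc]
        gcongr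

theorem iterate_stepMean_one_sub_le (x : Fin n) (k : ℕ) (G : Finset (Finset (Fin n))) :
    (stepMean n r)^[k] (fun G => 1 - fixedInd x G) G ≤ 1 := by
  have := iterate_stepMean_mono (n := n) (r := r) k
    (show (fun G => 1 - fixedInd x G) ≤ fun _ => (1 : ℝ) from fun G => by
      have := fixedInd_nonneg x G
      simpa using this) G
  rwa [iterate_stepMean_const] at this

/-- Once all the sets chosen so far contain `x`, each transversal has to compete with all the sets
that contain `x` and are disjoint from it. -/
theorem iterate_stepMean_escape_le (hr : 1 ≤ r) (hn : 2 * r < n) (k : ℕ)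
    (hF : F ⊆ fullStar n r x) : (stepMean n r)^[k] (fun G => 1 - fixedInd x G) F ≤
      (transversals r x F).card / (n - 1 - r).choose (r - 1) := by
  have hZ : (0 : ℝ) < (n - 1 - r).choose (r - 1) := by
    exact_mod_cast Nat.choose_pos (by omega)
  induction k generalizing F with
  | zero =>
    rw [Function.iterate_zero, id, fixedInd, if_pos (fixedBy_of_subset_fullStar hF), sub_self]
    positivity
  | succ k ih =>
    rw [Function.iterate_succ_apply']
    by_cases hA : (admissible n r F).Nonempty
    · have hsum := sum_admissible_le hr hn hF (iterate_stepMean_one_sub_le x k) fun G hG => ih hG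
      rw [stepMean_of_nonempty hA, div_le_iff₀ (by exact_mod_cast hA.card_pos)]
      refine hsum.trans ?_
      rw [div_mul_eq_mul_div, mul_div_assoc]
      have hle : (fullStar n r x \ F).card ≤ (admissible n r F).card := by
        rw [card_admissible_of_subset_fullStar hF]
        exact Nat.le_add_right _ _
      gcongr
    · rw [stepMean, if_neg hA]
      exact ih hF

theorem pair_subset_fullStar {e₁ e₂ : Finset (Fin n)} (h1 : e₁.card = r) (h2 : e₂.card = r)
    (hx : x ∈ e₁ ∩ e₂) : {e₂, e₁} ⊆ fullStar n r x := by
  rw [Finset.mem_inter] at hx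
  intro e he
  rw [Finset.mem_insert, Finset.mem_singleton] at he
  rcases he with rfl | rfl
  exacts [mem_fullStar.mpr ⟨h2, hx.2⟩, mem_fullStar.mpr ⟨h1, hx.1⟩]

theorem card_fullStar_sdiff_pair (hr : 1 ≤ r) {e₁ e₂ : Finset (Fin n)} (h1 : e₁.card = r)
    (h2 : e₂.card = r) (hne : e₁ ≠ e₂) (hx : x ∈ e₁ ∩ e₂) :
    (fullStar n r x \ {e₂, e₁}).card + 2 = (n - 1).choose (r - 1) := by
  rw [← card_fullStar hr x, ← Finset.card_sdiff_add_card_eq_card (pair_subset_fullStar h1 h2 hx),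
    Finset.card_pair hne.symm]

theorem le_choose_pred (hr : 2 ≤ r) (hn : 2 * r < n) : n - 1 ≤ (n - 1).choose (r - 1) :=
  le_choose_of_pos_of_lt (by omega) (by omega)

/-- The first summand bounds the chance that the third set leaves the star; the second one pays for
all later steps. The general bound, transversals over `(n - 1 - r).choose (r - 1)`, would be too
weak here, as it may exceed `1`; hence the third step is treated separately. -/
theorem iterate_stepMean_escape_pair_le (hr : 2 ≤ r) (hn : 2 * r < n) (k : ℕ)
    {e₁ e₂ : Finset (Fin n)} (h1 : e₁.card = r) (h2 : e₂.card = r) (hne : e₁ ≠ e₂)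
    (hx : e₁ ∩ e₂ = {x}) :
    (stepMean n r)^[k + 1] (fun G => 1 - fixedInd x G) {e₂, e₁} ≤
      (((r - 1) ^ 2 * (n - 2).choose (r - 2) : ℕ) : ℝ) /
        ((n - 1).choose (r - 1) - 2 + ((r - 1) ^ 2 * (n - 2).choose (r - 2) : ℕ)) +
      (((n - 1).choose (r - 1) : ℝ) / (n - 1 - r).choose (r - 1) - 1) := by
  have hxe : x ∈ e₁ ∩ e₂ := by rw [hx]; exact Finset.mem_singleton_self x
  have hF := pair_subset_fullStar h1 h2 hxe
  have hb := card_transversals_pair_le hr h1 h2 hx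
  have hM := card_fullStar_sdiff_pair (by omega) h1 h2 hne hxe
  have hN := le_choose_pred hr hn
  have hZN : (n - 1 - r).choose (r - 1) ≤ (n - 1).choose (r - 1) :=
    Nat.choose_le_choose _ (by omega)
  have hZ : (0 : ℝ) < (n - 1 - r).choose (r - 1) := by
    exact_mod_cast Nat.choose_pos (by omega)
  have hcard := card_admissible_of_subset_fullStar hF
  have hA : (admissible n r {e₂, e₁}).Nonempty := by
    rw [← Finset.card_pos]
    omega
  have hsum := sum_admissible_le (by omega) hn hF (iterate_stepMean_one_sub_le (r := r) x k)
    fun G hG => iterate_stepMean_escape_le (by omega) hn k hG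
  rw [Function.iterate_succ_apply', stepMean_of_nonempty hA, hcard]
  have hM' : (((fullStar n r x \ {e₂, e₁}).card : ℕ) : ℝ) = (n - 1).choose (r - 1) - 2 := by
    rw [← hM]
    push_cast
    ring
  have hMpos : (0 : ℝ) < ((fullStar n r x \ {e₂, e₁}).card : ℕ) := by
    exact_mod_cast (by omega)
  have hb' : ((transversals r x {e₂, e₁}).card : ℝ) ≤
      ((r - 1) ^ 2 * (n - 2).choose (r - 2) : ℕ) := by exact_mod_cast hb
  rw [← hM']
  have hN' : ((n - 1).choose (r - 1) : ℝ) = ((fullStar n r x \ {e₂, e₁}).card : ℕ) + 2 := by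
    rw [hM']; ring
  rw [hN']
  have hZN' : ((n - 1 - r).choose (r - 1) : ℝ) ≤ ((fullStar n r x \ {e₂, e₁}).card : ℕ) + 2 := by
    rw [← hN']
    exact_mod_cast hZN
  have hb0 : (0 : ℝ) ≤ (transversals r x {e₂, e₁}).card := Nat.cast_nonneg _
  generalize (((r - 1) ^ 2 * (n - 2).choose (r - 2) : ℕ) : ℝ) = b₁ at hb' ⊢
  push_cast
  generalize ((fullStar n r x \ {e₂, e₁}).card : ℝ) = M at *
  generalize ((transversals r x {e₂, e₁}).card : ℝ) = b at *
  generalize ((n - 1 - r).choose (r - 1) : ℝ) = Z at *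
  have hq : b / (M + b) ≤ b₁ / (M + b₁) := by
    rw [div_le_div_iff₀ (by linarith) (by linarith)]
    nlinarith
  have hq0 : 0 ≤ b / (M + b) := by positivity
  have hq1 : b / (M + b) ≤ 1 := by
    rw [div_le_one (by linarith)]
    linarith
  have hz0 : 0 ≤ (M + 2) / Z - 1 := by
    rw [sub_nonneg, one_le_div hZ]
    exact hZN'
  have hz1 : M / Z - 1 ≤ (M + 2) / Z - 1 := by
    gcongr
    linarith
  -- `b` transversals compete with `M` star sets, and `M / Z - 1` is the relative error.
  calc _ ≤ b * (M / Z) / (M + b) := by gcongr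
    _ = b / (M + b) + b / (M + b) * (M / Z - 1) := by
        field_simp
        ring
    _ ≤ b₁ / (M + b₁) + ((M + 2) / Z - 1) := by
        refine add_le_add hq ?_
        calc _ ≤ b / (M + b) * ((M + 2) / Z - 1) := by gcongr
          _ ≤ 1 * ((M + 2) / Z - 1) := by gcongr
          _ = _ := one_mul _

end Escape

/-- The lower bound for the probability of the Erdős–Ko–Rado event. -/
theorem one_sub_probEKR_le (hr : 2 ≤ r) (hn : 2 * r < n) :
    1 - probEKR n r ≤ (((r - 1) ^ 2 * (n - 2).choose (r - 2) : ℕ) : ℝ) /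
        ((n - 1).choose (r - 1) - 2 + ((r - 1) ^ 2 * (n - 2).choose (r - 2) : ℕ)) +
      (((n - 1).choose (r - 1) : ℝ) / (n - 1 - r).choose (r - 1) - 1) +
      (((n - 1).choose (r - 1) : ℝ) / (n - r).choose (r - 1) - 1) := by
  set a := (((r - 1) ^ 2 * (n - 2).choose (r - 2) : ℕ) : ℝ) /
        ((n - 1).choose (r - 1) - 2 + ((r - 1) ^ 2 * (n - 2).choose (r - 2) : ℕ)) +
      (((n - 1).choose (r - 1) : ℝ) / (n - 1 - r).choose (r - 1) - 1) with ha
  have hZN : (n - 1 - r).choose (r - 1) ≤ (n - 1).choose (r - 1) :=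
    Nat.choose_le_choose _ (by omega)
  have hZ : (0 : ℝ) < (n - 1 - r).choose (r - 1) := by
    exact_mod_cast Nat.choose_pos (by omega)
  have hN : (2 : ℝ) ≤ (n - 1).choose (r - 1) := by
    exact_mod_cast (by omega : 2 ≤ n - 1).trans (le_choose_pred hr hn)
  have ha0 : 0 ≤ a := by
    refine add_nonneg (div_nonneg (Nat.cast_nonneg _) (add_nonneg (by linarith)
      (Nat.cast_nonneg _))) ?_
    rw [sub_nonneg, one_le_div hZ]
    exact_mod_cast hZN
  -- Two steps for the first two sets, one for the third, and `k` for the rest.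
  obtain ⟨k, hk⟩ : ∃ k, n.choose r = k + 1 + 2 :=
    ⟨n.choose r - 3, by have := le_choose_of_pos_of_lt (by omega : 1 ≤ r) (by omega : r < n); omega⟩
  have h1 : 1 - probEKR n r = (stepMean n r)^[n.choose r] ((fun _ => 1) - commonInd) ∅ := by
    rw [iterate_stepMean_sub, iterate_stepMean_const, probEKR_eq (by omega) hn]
    rfl
  rw [h1, hk, add_comm, Function.iterate_add_apply]
  -- The affine bound `a - 1 + |e₁ ∩ e₂|` equals `a` when the intersection is a single element and
  -- is at least the trivial bound `1` otherwise.
  refine (iterate_two_stepMean_le hr hn (α := a - 1) (β := 1) zero_le_one ?_).trans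
    (le_of_eq (by ring))
  intro e₁ e₂ h1 h2 hne hint
  rcases Nat.lt_or_ge 1 (e₁ ∩ e₂).card with h | h
  · have hle := iterate_stepMean_mono (n := n) (r := r) (k + 1)
      (show (fun _ => 1) - commonInd ≤ fun _ => (1 : ℝ) from fun G => by
        have := commonInd_nonneg G
        simpa using this) {e₂, e₁}
    rw [iterate_stepMean_const] at hle
    have : (2 : ℝ) ≤ (e₁ ∩ e₂).card := by exact_mod_cast h
    linarith
  · obtain ⟨x, hx⟩ := Finset.card_eq_one.mp (le_antisymm h hint.card_pos)
    have hle := iterate_stepMean_mono (n := n) (r := r) (k + 1)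
      (show (fun _ => 1) - commonInd ≤ fun G => 1 - fixedInd x G from fun G => by
        show 1 - commonInd G ≤ 1 - fixedInd x G
        linarith [fixedInd_le_commonInd x G]) {e₂, e₁}
    have := iterate_stepMean_escape_pair_le hr hn k h1 h2 hne hx
    rw [hx, Finset.card_singleton]
    push_cast
    linarith

theorem one_sub_probEKR_one_le (hn : 2 < n) : 1 - probEKR n 1 ≤ 0 := by
  obtain ⟨k, hk⟩ : ∃ k, n.choose 1 = k + 1 := ⟨n - 1, by simp; omega⟩
  have h1 : 1 - probEKR n 1 = (stepMean n 1)^[n.choose 1] ((fun _ => 1) - commonInd) ∅ := by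
    rw [iterate_stepMean_sub, iterate_stepMean_const, probEKR_eq le_rfl (by omega)]
    rfl
  rw [h1, hk, Function.iterate_succ_apply']
  refine stepMean_le_of_forall (admissible_empty_nonempty (by omega)) fun e he => ?_
  obtain ⟨x, rfl⟩ := Finset.card_eq_one.mp (mem_admissible.mp he).1
  have hle := iterate_stepMean_mono (n := n) (r := 1) k
    (show (fun _ => 1) - commonInd ≤ fun G => 1 - fixedInd x G from fun G => by
      show 1 - commonInd G ≤ 1 - fixedInd x G
      linarith [fixedInd_le_commonInd x G]) {{x}}
  have hesc := iterate_stepMean_escape_le (n := n) (r := 1) (x := x) (F := {{x}}) le_rfl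
    (by omega) k (by simp [mem_fullStar])
  have hemp : transversals 1 x {{x}} = ∅ := by
    ext f
    simp only [mem_transversals, Finset.mem_singleton, forall_eq, Finset.notMem_empty, iff_false]
    rintro ⟨-, hxf, hf⟩
    exact hf.ne_empty (Finset.inter_singleton_of_notMem hxf)
  rw [hemp] at hesc
  simp only [Finset.card_empty, Nat.cast_zero, zero_div] at hesc
  rw [insert_empty_eq]
  exact hle.trans hesc

theorem iterate_three_stepMean_eq :
    (stepMean n r)^[3] commonInd ∅ = (stepMean n r)^[2] (stepMean n r commonInd) ∅ := rfl

/-- Every transversal chosen as third set destroys the only possible common element, and the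
crossing sets bound the number of transversals from below. -/
theorem stepMean_commonInd_pair_le (hr : 2 ≤ r) (hn : 2 * r < n) {e₁ e₂ : Finset (Fin n)}
    (h1 : e₁.card = r) (h2 : e₂.card = r) (hne : e₁ ≠ e₂) {x : Fin n} (hx : e₁ ∩ e₂ = {x}) :
    stepMean n r commonInd {e₂, e₁} ≤ ((n - 1).choose (r - 1) : ℝ) /
      ((n - 1).choose (r - 1) + ((r - 1) ^ 2 * (n - (2 * r - 1)).choose (r - 2) : ℕ)) := by
  have hxe : x ∈ e₁ ∩ e₂ := by rw [hx]; exact Finset.mem_singleton_self x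
  have hF := pair_subset_fullStar h1 h2 hxe
  have hb := Finset.card_le_card (crossingSets_subset_transversals (r := r) hxe)
  rw [card_crossingSets hr h1 h2, hx, Finset.card_singleton] at hb
  have hM := card_fullStar_sdiff_pair (by omega) h1 h2 hne hxe
  have hN := le_choose_pred hr hn
  have hcard := card_admissible_of_subset_fullStar hF
  have hA : (admissible n r {e₂, e₁}).Nonempty := by
    rw [← Finset.card_pos]
    omega
  rw [stepMean_of_nonempty hA, hcard, sum_admissible_of_subset_fullStar hF]
  have a1 : ∑ e ∈ transversals r x {e₂, e₁}, commonInd (insert e {e₂, e₁}) ≤ 0 := by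
    refine Finset.sum_nonpos fun e he => ?_
    rw [commonInd, if_neg]
    rintro ⟨y, hy⟩
    have hy' : y ∈ e₁ ∩ e₂ := Finset.mem_inter.mpr ⟨hy e₁ (by simp), hy e₂ (by simp)⟩
    rw [hx, Finset.mem_singleton] at hy'
    subst hy'
    exact (mem_transversals.mp he).2.1 (hy e (by simp))
  have a2 : ∑ e ∈ fullStar n r x \ {e₂, e₁}, commonInd (insert e {e₂, e₁}) ≤
      (fullStar n r x \ {e₂, e₁}).card := by
    calc _ ≤ ∑ e ∈ fullStar n r x \ {e₂, e₁}, (1 : ℝ) :=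
          Finset.sum_le_sum fun e _ => commonInd_le_one _
      _ = _ := by simp
  have hM' : ((n - 1).choose (r - 1) : ℝ) = (fullStar n r x \ {e₂, e₁}).card + 2 := by
    exact_mod_cast hM.symm
  have hb' : (((r - 1) ^ 2 * (n - (2 * r - 1)).choose (r - 2) : ℕ) : ℝ) ≤
      (transversals r x {e₂, e₁}).card := by exact_mod_cast hb
  have hMpos : (0 : ℝ) < (fullStar n r x \ {e₂, e₁}).card := by
    exact_mod_cast (by omega)
  have hb0 : (0 : ℝ) ≤ ((r - 1) ^ 2 * (n - (2 * r - 1)).choose (r - 2) : ℕ) := Nat.cast_nonneg _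
  rw [hM']
  generalize (((r - 1) ^ 2 * (n - (2 * r - 1)).choose (r - 2) : ℕ) : ℝ) = b₀ at *
  push_cast
  generalize ((fullStar n r x \ {e₂, e₁}).card : ℝ) = M at *
  generalize ((transversals r x {e₂, e₁}).card : ℝ) = b at *
  calc _ ≤ M / (M + b) :=
        div_le_div_of_nonneg_right ((add_le_add a2 a1).trans_eq (add_zero _)) (by linarith)
    _ ≤ M / (M + b₀) := by gcongr
    _ ≤ _ := by
        rw [div_le_div_iff₀ (by linarith) (by linarith)]
        nlinarith

/-- The upper bound for the probability of the Erdős–Ko–Rado event that is asymptotically sharp when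
the first two sets typically meet in one element. -/
theorem probEKR_le_of_pair (hr : 2 ≤ r) (hn : 2 * r < n) :
    probEKR n r ≤ ((n - 1).choose (r - 1) : ℝ) /
      ((n - 1).choose (r - 1) + ((r - 1) ^ 2 * (n - (2 * r - 1)).choose (r - 2) : ℕ)) +
      (((n - 1).choose (r - 1) : ℝ) / (n - r).choose (r - 1) - 1) := by
  have h3 : 3 ≤ n.choose r := by
    have := le_choose_of_pos_of_lt (by omega : 1 ≤ r) (by omega : r < n)
    omega
  refine (probEKR_le_iterate (by omega) hn h3).trans ?_
  rw [iterate_three_stepMean_eq]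
  set a := ((n - 1).choose (r - 1) : ℝ) /
      ((n - 1).choose (r - 1) + ((r - 1) ^ 2 * (n - (2 * r - 1)).choose (r - 2) : ℕ)) with ha
  have ha0 : 0 ≤ a := by positivity
  refine (iterate_two_stepMean_le hr hn (α := a - 1) (β := 1) zero_le_one ?_).trans
    (le_of_eq (by ring))
  intro e₁ e₂ h1 h2 hne hint
  rcases Nat.lt_or_ge 1 (e₁ ∩ e₂).card with h | h
  · have h4 : stepMean n r commonInd {e₂, e₁} ≤ 1 :=
      (stepMean_commonInd_le _).trans (commonInd_le_one _)
    have : (2 : ℝ) ≤ (e₁ ∩ e₂).card := by exact_mod_cast h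
    linarith
  · obtain ⟨x, hx⟩ := Finset.card_eq_one.mp (le_antisymm h hint.card_pos)
    have := stepMean_commonInd_pair_le hr hn h1 h2 hne hx
    rw [hx, Finset.card_singleton]
    push_cast
    linarith

/-- The third set meets the intersection of the first two only with a probability proportional to
the size of that intersection. -/
theorem probEKR_le_of_triple (hr : 2 ≤ r) (hn : 3 * r < n) :
    probEKR n r ≤ (2 / r + ((n - 1).choose (r - 1) : ℝ) /
        ((r / 2) ^ 2 * (n - 2 * r).choose (r - 2))) *
      (((n - 1).choose (r - 1) : ℝ) / (n - r).choose (r - 1)) := by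
  have h3 : 3 ≤ n.choose r := by
    have := le_choose_of_pos_of_lt (by omega : 1 ≤ r) (by omega : r < n)
    omega
  refine (probEKR_le_iterate (by omega) (by omega) h3).trans ?_
  rw [iterate_three_stepMean_eq]
  have hC : (0 : ℝ) < (n - 2 * r).choose (r - 2) := by
    exact_mod_cast Nat.choose_pos (by omega)
  have hr0 : (0 : ℝ) < r := by exact_mod_cast (by omega : 0 < r)
  refine (iterate_two_stepMean_le hr (by omega) (α := 0) (β := 2 / r + ((n - 1).choose (r - 1) : ℝ) /
        ((r / 2) ^ 2 * (n - 2 * r).choose (r - 2))) (by positivity) ?_).trans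
    (le_of_eq (by ring))
  intro e₁ e₂ h1 h2 hne hint
  rw [zero_add, add_mul]
  have hk0 : (0 : ℝ) ≤ (e₁ ∩ e₂).card := Nat.cast_nonneg _
  -- A large intersection is paid for by the term `2 / r`; for a small one at least `r / 2` elements
  -- of each set lie outside it, so there are many crossing sets.
  rcases le_or_gt (r : ℝ) (2 * (e₁ ∩ e₂).card) with h | h
  · have h4 : stepMean n r commonInd {e₂, e₁} ≤ 1 :=
      (stepMean_commonInd_le _).trans (commonInd_le_one _)
    have h5 : 1 ≤ 2 / (r : ℝ) * (e₁ ∩ e₂).card := by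
      rw [div_mul_eq_mul_div, one_le_div hr0]
      exact h
    have h6 : 0 ≤ ((n - 1).choose (r - 1) : ℝ) /
        ((r / 2) ^ 2 * (n - 2 * r).choose (r - 2)) * (e₁ ∩ e₂).card := by positivity
    linarith
  · have hcross := Finset.card_le_card (crossingSets_subset_admissible (r := r) hint)
    rw [card_crossingSets hr h1 h2] at hcross
    have hk : (e₁ ∩ e₂).card ≤ r := h1 ▸ Finset.card_le_card Finset.inter_subset_left
    have hA : (r / 2 : ℝ) ^ 2 * (n - 2 * r).choose (r - 2) ≤ (admissible n r {e₂, e₁}).card := by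
      have c1 : ((n - 2 * r).choose (r - 2) : ℝ) ≤
          (n - (2 * r - (e₁ ∩ e₂).card)).choose (r - 2) := by
        exact_mod_cast Nat.choose_le_choose _ (by omega)
      have c2 : (((r - (e₁ ∩ e₂).card) ^ 2 *
          (n - (2 * r - (e₁ ∩ e₂).card)).choose (r - 2) : ℕ) : ℝ) ≤
          (admissible n r {e₂, e₁}).card := by exact_mod_cast hcross
      rw [Nat.cast_mul, Nat.cast_pow, Nat.cast_sub hk] at c2
      refine le_trans ?_ c2
      gcongr
      linarith
    have hpos : (0 : ℝ) < (r / 2 : ℝ) ^ 2 * (n - 2 * r).choose (r - 2) := by positivity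
    have hne' : (admissible n r {e₂, e₁}).Nonempty := by
      rw [← Finset.card_pos]
      exact_mod_cast hpos.trans_le hA
    have hsum : ∑ e ∈ admissible n r {e₂, e₁}, commonInd (insert e {e₂, e₁}) ≤
        (e₁ ∩ e₂).card * (n - 1).choose (r - 1) := by
      calc ∑ e ∈ admissible n r {e₂, e₁}, commonInd (insert e {e₂, e₁})
          ≤ ∑ e ∈ admissible n r {e₂, e₁}, ∑ y ∈ e₁ ∩ e₂, if y ∈ e then (1 : ℝ) else 0 := by
            refine Finset.sum_le_sum fun e _ => ?_
            by_cases hcom : ∃ y, FixedBy (insert e {e₂, e₁}) y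
            · rw [commonInd, if_pos hcom]
              obtain ⟨y, hy⟩ := hcom
              calc (1 : ℝ) = if y ∈ e then 1 else 0 := by rw [if_pos (hy e (by simp))]
                _ ≤ _ := Finset.single_le_sum (f := fun y => if y ∈ e then (1 : ℝ) else 0)
                  (fun z _ => by positivity)
                  (Finset.mem_inter.mpr ⟨hy e₁ (by simp), hy e₂ (by simp)⟩)
            · rw [commonInd, if_neg hcom]
              positivity
        _ ≤ ∑ e ∈ Finset.powersetCard r Finset.univ, ∑ y ∈ e₁ ∩ e₂,
              if y ∈ e then (1 : ℝ) else 0 :=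
            Finset.sum_le_sum_of_subset_of_nonneg (Finset.filter_subset _ _)
              fun e _ _ => by positivity
        _ = ∑ y ∈ e₁ ∩ e₂, ((fullStar n r y).card : ℝ) := by
            rw [Finset.sum_comm]
            simp only [fullStar, Finset.card_filter]
            push_cast
            rfl
        _ = _ := by
            rw [Finset.sum_congr rfl fun y _ => by rw [card_fullStar (by omega) y],
              Finset.sum_const, nsmul_eq_mul]
    rw [stepMean_of_nonempty hne']
    have h5 : 0 ≤ 2 / (r : ℝ) * (e₁ ∩ e₂).card := by positivity
    calc _ ≤ (e₁ ∩ e₂).card * ((n - 1).choose (r - 1) : ℝ) /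
          ((r / 2 : ℝ) ^ 2 * (n - 2 * r).choose (r - 2)) := by gcongr
      _ = ((n - 1).choose (r - 1) : ℝ) /
        ((r / 2) ^ 2 * (n - 2 * r).choose (r - 2)) * (e₁ ∩ e₂).card := by ring
      _ ≤ _ := by linarith

theorem iterate_stepMean_fixedInd_of_not {x : Fin n} (k : ℕ) {F : Finset (Finset (Fin n))}
    (hF : ¬ FixedBy F x) : (stepMean n r)^[k] (fixedInd x) F ≤ 0 := by
  induction k generalizing F with
  | zero => rw [Function.iterate_zero, id, fixedInd, if_neg hF]
  | succ k ih =>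
    rw [Function.iterate_succ_apply']
    by_cases hA : (admissible n r F).Nonempty
    · exact stepMean_le_of_forall hA fun e _ =>
        ih fun h => hF (h.mono (Finset.subset_insert e F))
    · rw [stepMean, if_neg hA]
      exact ih hF

/-- While fewer than `m` sets have been chosen at least `D` sets are admissible, so each new set
contains `x` with probability at most `(n-1).choose (r-1) / D`. -/
theorem iterate_stepMean_fixedInd_le (hr : 1 ≤ r) {m : ℕ} {D : ℝ} (hD : 0 < D)
    (hDle : D ≤ n.choose r - m * ((n - r).choose r + 1)) (x : Fin n) (k : ℕ)
    {F : Finset (Finset (Fin n))} (hF : F ⊆ fullStar n r x) (hk : F.card + k ≤ m) :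
    (stepMean n r)^[k] (fixedInd x) F ≤ ((n - 1).choose (r - 1) / D) ^ k := by
  induction k generalizing F with
  | zero =>
    rw [Function.iterate_zero, id, fixedInd, if_pos (fixedBy_of_subset_fullStar hF), pow_zero]
  | succ k ih =>
    rw [Function.iterate_succ_apply']
    have hge : (n.choose r : ℝ) ≤ (admissible n r F).card + F.card * ((n - r).choose r + 1) := by
      exact_mod_cast card_admissible_ge F fun f hf => (mem_fullStar.mp (hF hf)).1
    have hFm : (F.card : ℝ) ≤ m := by exact_mod_cast (by omega : F.card ≤ m)
    have hDA : D ≤ (admissible n r F).card := by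
      have : (F.card : ℝ) * ((n - r).choose r + 1) ≤ m * ((n - r).choose r + 1) := by gcongr
      linarith
    have hA : (admissible n r F).Nonempty := by
      rw [← Finset.card_pos]
      exact_mod_cast hD.trans_le hDA
    rw [stepMean_of_nonempty hA, sum_admissible_of_subset_fullStar hF]
    have a1 : ∑ e ∈ transversals r x F, (stepMean n r)^[k] (fixedInd x) (insert e F) ≤ 0 :=
      Finset.sum_nonpos fun e he => iterate_stepMean_fixedInd_of_not k fun h =>
        (mem_transversals.mp he).2.1 (h e (Finset.mem_insert_self e F))
    have a2 : ∑ e ∈ fullStar n r x \ F, (stepMean n r)^[k] (fixedInd x) (insert e F) ≤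
        (n - 1).choose (r - 1) * ((n - 1).choose (r - 1) / D) ^ k := by
      calc _ ≤ ∑ e ∈ fullStar n r x \ F, ((n - 1).choose (r - 1) / D) ^ k := by
            refine Finset.sum_le_sum fun e he => ih (insert_subset_fullStar hF he) ?_
            have := Finset.card_insert_le e F
            omega
        _ = (fullStar n r x \ F).card * ((n - 1).choose (r - 1) / D) ^ k := by
            rw [Finset.sum_const, nsmul_eq_mul]
        _ ≤ _ := by
            have : (fullStar n r x \ F).card ≤ (n - 1).choose (r - 1) := by
              rw [← card_fullStar hr x]
              exact Finset.card_le_card Finset.sdiff_subset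
            gcongr
    calc _ ≤ ((n - 1).choose (r - 1) * ((n - 1).choose (r - 1) / D) ^ k) / D := by
          gcongr
          linarith
      _ = _ := by ring

/-- A union bound over the common element of the first `m` sets. -/
theorem probEKR_le_of_prefix (hr : 1 ≤ r) (hn : 2 * r < n) {m : ℕ} (hm : m ≤ n.choose r) {D : ℝ}
    (hD : 0 < D) (hDle : D ≤ n.choose r - m * ((n - r).choose r + 1)) :
    probEKR n r ≤ n * ((n - 1).choose (r - 1) / D) ^ m := by
  refine (probEKR_le_iterate hr hn hm).trans ?_
  have h := iterate_stepMean_mono (n := n) (r := r) m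
    (show commonInd ≤ fun F => ∑ x, fixedInd x F from commonInd_le_sum_fixedInd) ∅
  rw [iterate_stepMean_sum] at h
  refine h.trans ?_
  calc ∑ x, (stepMean n r)^[m] (fixedInd x) ∅
      ≤ ∑ x : Fin n, ((n - 1).choose (r - 1) / D) ^ m :=
        Finset.sum_le_sum fun x _ => iterate_stepMean_fixedInd_le hr hD hDle x m
          (Finset.empty_subset _) (by simp)
    _ = _ := by simp

end Bounds

/-! ### Ratios of binomial coefficients. -/

section BinomialEstimates

theorem choose_add_le_mul_exp {m k : ℕ} (hk : k ≤ m) (s : ℕ) :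
    ((m + s).choose k : ℝ) ≤ m.choose k * Real.exp (s * k / (m + 1 - k)) := by
  have hkm : (k : ℝ) ≤ m := by exact_mod_cast hk
  have hpos : (0 : ℝ) < m + 1 - k := by linarith
  induction s with
  | zero => simp
  | succ s ih =>
    have h1 : ((m + s).choose k : ℝ) * (m + s + 1) = (m + s + 1).choose k * (m + s + 1 - k) := by
      have := congrArg (Nat.cast (R := ℝ)) (Nat.choose_mul_succ_eq (m + s) k)
      rw [Nat.cast_mul, Nat.cast_mul, Nat.cast_sub (by omega)] at this
      push_cast at this
      exact this
    have hs : (0 : ℝ) ≤ s := Nat.cast_nonneg s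
    have hk0 : (0 : ℝ) ≤ k := Nat.cast_nonneg k
    have hpos' : (0 : ℝ) < m + s + 1 - k := by linarith
    have h2 : ((m + s + 1).choose k : ℝ) = (m + s).choose k * (1 + k / (m + s + 1 - k)) := by
      rw [one_add_div hpos'.ne', mul_div_assoc', eq_div_iff hpos'.ne', ← h1]
      ring
    have h3 : 1 + (k : ℝ) / (m + s + 1 - k) ≤ Real.exp (k / (m + 1 - k)) := by
      have h4 : (k : ℝ) / (m + s + 1 - k) ≤ k / (m + 1 - k) := by
        gcongr
        linarith
      linarith [Real.add_one_le_exp ((k : ℝ) / (m + 1 - k))]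
    calc ((m + (s + 1)).choose k : ℝ) = (m + s).choose k * (1 + k / (m + s + 1 - k)) := h2
      _ ≤ m.choose k * Real.exp (s * k / (m + 1 - k)) * Real.exp (k / (m + 1 - k)) := by gcongr
      _ = _ := by
        rw [mul_assoc, ← Real.exp_add]
        congr 2
        push_cast
        ring

theorem choose_le_choose_add_mul_exp (m k s : ℕ) (hs : 0 < m + s) :
    (m.choose k : ℝ) ≤ (m + s).choose k * Real.exp (-(s * k / (m + s))) := by
  have hpos : (0 : ℝ) < m + s := by exact_mod_cast hs
  have key : ∀ t ≤ s, (m.choose k : ℝ) ≤ (m + t).choose k * Real.exp (-(t * k / (m + s))) := by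
    intro t
    induction t with
    | zero => intro _; simp
    | succ t ih =>
      intro ht
      have ih := ih (by omega)
      have hts : (t : ℝ) + 1 ≤ s := by exact_mod_cast ht
      have ht0 : (0 : ℝ) ≤ t := Nat.cast_nonneg t
      have hm0 : (0 : ℝ) ≤ m := Nat.cast_nonneg m
      have h2 : ((m + t).choose k : ℝ) ≤ (m + t + 1).choose k * Real.exp (-(k / (m + s))) := by
        rcases Nat.lt_or_ge (m + t) k with h | h
        · rw [Nat.choose_eq_zero_of_lt h, Nat.cast_zero]
          positivity
        have h1 : ((m + t).choose k : ℝ) * (m + t + 1) = (m + t + 1).choose k * (m + t + 1 - k) := by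
          have := congrArg (Nat.cast (R := ℝ)) (Nat.choose_mul_succ_eq (m + t) k)
          rw [Nat.cast_mul, Nat.cast_mul, Nat.cast_sub (by omega)] at this
          push_cast at this
          exact this
        have h4 : (0 : ℝ) < m + t + 1 := by linarith
        have h3 : ((m + t).choose k : ℝ) = (m + t + 1).choose k * (1 - k / (m + t + 1)) := by
          rw [one_sub_div h4.ne', mul_div_assoc', eq_div_iff h4.ne', ← h1]
        rw [h3]
        gcongr
        have h5 : (k : ℝ) / (m + s) ≤ k / (m + t + 1) :=
          div_le_div_of_nonneg_left (Nat.cast_nonneg k) h4 (by linarith)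
        linarith [Real.add_one_le_exp (-((k : ℝ) / (m + s)))]
      calc (m.choose k : ℝ) ≤ (m + t).choose k * Real.exp (-(t * k / (m + s))) := ih
        _ ≤ (m + t + 1).choose k * Real.exp (-(k / (m + s))) *
            Real.exp (-(t * k / (m + s))) := by gcongr
        _ = _ := by
          rw [mul_assoc, ← Real.exp_add]
          congr 2
          push_cast
          ring
  exact key s le_rfl

theorem div_le_exp_of_choose_add {a m k s : ℕ} {z : ℝ} (ha : a = m + s) (hk : k ≤ m)
    (hz : (s * k / (m + 1 - k) : ℝ) ≤ z) : (a.choose k : ℝ) / m.choose k ≤ Real.exp z := by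
  have hpos : (0 : ℝ) < m.choose k := by exact_mod_cast Nat.choose_pos hk
  rw [div_le_iff₀ hpos, ha, mul_comm]
  exact (choose_add_le_mul_exp hk s).trans (by gcongr)

variable {n r : ℕ}

/-- For `6 * r ≤ n` the denominator `m + 1 - k` in the exponent is at least `n / 2`, here and in the
next three ratios; this explains the constants `2` and `4`. -/
theorem choose_ratio_sub (hr : 1 ≤ r) (hn : 6 * r ≤ n) :
    ((n - 1).choose (r - 1) : ℝ) / (n - r).choose (r - 1) ≤ Real.exp (2 * (r ^ 2 / n)) := by
  refine div_le_exp_of_choose_add (s := r - 1) (by omega) (by omega) ?_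
  have hn' : (6 : ℝ) * r ≤ n := by exact_mod_cast hn
  have hr' : (1 : ℝ) ≤ r := by exact_mod_cast hr
  rw [Nat.cast_sub hr, Nat.cast_sub (by omega : r ≤ n), ← mul_div_assoc,
    div_le_div_iff₀ (by push_cast; linarith) (by linarith)]
  push_cast
  nlinarith [mul_nonneg (sq_nonneg (r : ℝ)) (by linarith : (0 : ℝ) ≤ n - 6 * r)]

theorem choose_ratio_sub_pred (hr : 1 ≤ r) (hn : 6 * r ≤ n) :
    ((n - 1).choose (r - 1) : ℝ) / (n - 1 - r).choose (r - 1) ≤ Real.exp (2 * (r ^ 2 / n)) := by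
  refine div_le_exp_of_choose_add (s := r) (by omega) (by omega) ?_
  have hn' : (6 : ℝ) * r ≤ n := by exact_mod_cast hn
  have hr' : (1 : ℝ) ≤ r := by exact_mod_cast hr
  rw [Nat.cast_sub hr, Nat.cast_sub (by omega : r ≤ n - 1),
    Nat.cast_sub (by omega : 1 ≤ n), ← mul_div_assoc,
    div_le_div_iff₀ (by push_cast; linarith) (by linarith)]
  push_cast
  nlinarith [mul_nonneg (sq_nonneg (r : ℝ)) (by linarith : (0 : ℝ) ≤ n - 6 * r)]

theorem choose_ratio_sub_two_mul_pred (hr : 2 ≤ r) (hn : 6 * r ≤ n) :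
    ((n - 2).choose (r - 2) : ℝ) / (n - (2 * r - 1)).choose (r - 2) ≤
      Real.exp (4 * (r ^ 2 / n)) := by
  refine div_le_exp_of_choose_add (s := 2 * r - 3) (by omega) (by omega) ?_
  have hn' : (6 : ℝ) * r ≤ n := by exact_mod_cast hn
  have hr' : (2 : ℝ) ≤ r := by exact_mod_cast hr
  rw [Nat.cast_sub (by omega), Nat.cast_sub hr, Nat.cast_sub (by omega), Nat.cast_sub (by omega),
    ← mul_div_assoc, div_le_div_iff₀ (by push_cast; linarith) (by linarith)]
  push_cast
  nlinarith [mul_nonneg (sq_nonneg (r : ℝ)) (by linarith : (0 : ℝ) ≤ n - 6 * r)]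

theorem choose_ratio_sub_two_mul (hr : 2 ≤ r) (hn : 6 * r ≤ n) :
    ((n - 2).choose (r - 2) : ℝ) / (n - 2 * r).choose (r - 2) ≤
      Real.exp (4 * (r ^ 2 / n)) := by
  refine div_le_exp_of_choose_add (s := 2 * r - 2) (by omega) (by omega) ?_
  have hn' : (6 : ℝ) * r ≤ n := by exact_mod_cast hn
  have hr' : (2 : ℝ) ≤ r := by exact_mod_cast hr
  rw [Nat.cast_sub (by omega), Nat.cast_sub hr, Nat.cast_sub (by omega),
    ← mul_div_assoc, div_le_div_iff₀ (by push_cast; linarith) (by linarith)]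
  push_cast
  nlinarith [mul_nonneg (sq_nonneg (r : ℝ)) (by linarith : (0 : ℝ) ≤ n - 6 * r)]

theorem pred_mul_choose_pred (hr : 2 ≤ r) (hn : r ≤ n) :
    ((n : ℝ) - 1) * (n - 2).choose (r - 2) = (n - 1).choose (r - 1) * ((r : ℝ) - 1) := by
  obtain ⟨s, rfl⟩ : ∃ s, r = s + 2 := ⟨r - 2, by omega⟩
  obtain ⟨m, rfl⟩ : ∃ m, n = m + 2 := ⟨n - 2, by omega⟩
  have := congrArg (Nat.cast (R := ℝ)) (Nat.add_one_mul_choose_eq m s)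
  push_cast at this ⊢
  rw [show (m : ℝ) + 2 - 1 = m + 1 by ring, show (s : ℝ) + 2 - 1 = s + 1 by ring]
  exact this

theorem mul_choose_pred (hr : 1 ≤ r) (hn : r ≤ n) :
    (n : ℝ) * (n - 1).choose (r - 1) = n.choose r * (r : ℝ) := by
  obtain ⟨s, rfl⟩ : ∃ s, r = s + 1 := ⟨r - 1, by omega⟩
  obtain ⟨m, rfl⟩ : ∃ m, n = m + 1 := ⟨n - 1, by omega⟩
  have := congrArg (Nat.cast (R := ℝ)) (Nat.add_one_mul_choose_eq m s)
  simp only [Nat.add_sub_cancel]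
  push_cast at this ⊢
  exact this

end BinomialEstimates

/-! ### Explicit bounds in terms of `r²/n` and `r³/n`. -/

section Limits

variable {n r : ℕ}

/-- `ρ` is exactly the ratio of `(r-1)² * (n-2).choose (r-2)` to `(n-1).choose (r-1)`. The case `r =
1` is separate because the pair bounds need `2 ≤ r`. -/
theorem one_sub_probEKR_le_of_small (hr : 1 ≤ r) (hn : 6 * r ≤ n) {ρ : ℝ}
    (hρ : ρ = ((r : ℝ) - 1) ^ 3 / (n - 1)) :
    1 - probEKR n r ≤ ρ / (1 - 2 / (n - 1) + ρ) + 2 * (Real.exp (2 * (r ^ 2 / n)) - 1) := by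
  have hr' : (1 : ℝ) ≤ r := by exact_mod_cast hr
  have hn' : (6 : ℝ) * r ≤ n := by exact_mod_cast hn
  have hn1 : (0 : ℝ) < n - 1 := by linarith
  have hρ0 : 0 ≤ ρ := by
    rw [hρ]
    exact div_nonneg (pow_nonneg (by linarith) 3) hn1.le
  have h2n : 2 / ((n : ℝ) - 1) < 1 := by
    rw [div_lt_one hn1]
    linarith
  have he : 1 ≤ Real.exp (2 * (r ^ 2 / n)) := Real.one_le_exp (by positivity)
  rcases Nat.lt_or_ge r 2 with h | h
  · obtain rfl : r = 1 := by omega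
    refine (one_sub_probEKR_one_le (by omega)).trans ?_
    refine add_nonneg (div_nonneg hρ0 (by linarith)) (by linarith)
  have hN := le_choose_pred h (by omega : 2 * r < n)
  have hN' : (n : ℝ) - 1 ≤ (n - 1).choose (r - 1) := by
    have : (((n - 1 : ℕ)) : ℝ) ≤ (n - 1).choose (r - 1) := by exact_mod_cast hN
    rwa [Nat.cast_sub (by omega), Nat.cast_one] at this
  have hNpos : (0 : ℝ) < (n - 1).choose (r - 1) := by linarith
  have hb : (((r - 1) ^ 2 * (n - 2).choose (r - 2) : ℕ) : ℝ) = (n - 1).choose (r - 1) * ρ := by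
    rw [hρ, mul_div_assoc', eq_div_iff hn1.ne']
    rw [Nat.cast_mul, Nat.cast_pow, Nat.cast_sub hr, Nat.cast_one, mul_assoc, mul_comm _ ((n : ℝ) - 1),
      pred_mul_choose_pred h (by omega)]
    ring
  refine (one_sub_probEKR_le h (by omega)).trans ?_
  rw [hb]
  have h1 := choose_ratio_sub hr hn
  have h2 := choose_ratio_sub_pred hr hn
  have h3 : ((n - 1).choose (r - 1) * ρ : ℝ) / ((n - 1).choose (r - 1) - 2 +
      (n - 1).choose (r - 1) * ρ) ≤ ρ / (1 - 2 / (n - 1) + ρ) := by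
    have e : ((n - 1).choose (r - 1) * ρ : ℝ) / ((n - 1).choose (r - 1) - 2 +
      (n - 1).choose (r - 1) * ρ) = ρ / (1 - 2 / (n - 1).choose (r - 1) + ρ) := by
      rw [← mul_div_mul_left ρ _ hNpos.ne']
      congr 1
      field_simp
    rw [e]
    have h4 : (2 : ℝ) / (n - 1).choose (r - 1) ≤ 2 / (n - 1) := by gcongr
    apply div_le_div_of_nonneg_left hρ0 (by linarith) (by linarith)
  linarith

theorem probEKR_le_of_small (hr : 1 ≤ r) (hn : 6 * r ≤ n) {ρ : ℝ}
    (hρ : ρ = ((r : ℝ) - 1) ^ 3 / (n - 1)) :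
    probEKR n r ≤ 1 / (1 + ρ * Real.exp (-(4 * (r ^ 2 / n)))) +
      (Real.exp (2 * (r ^ 2 / n)) - 1) := by
  have hr' : (1 : ℝ) ≤ r := by exact_mod_cast hr
  have hn' : (6 : ℝ) * r ≤ n := by exact_mod_cast hn
  have hn1 : (0 : ℝ) < n - 1 := by linarith
  have hρ0 : 0 ≤ ρ := by
    rw [hρ]
    exact div_nonneg (pow_nonneg (by linarith) 3) hn1.le
  have he : 1 ≤ Real.exp (2 * (r ^ 2 / n)) := Real.one_le_exp (by positivity)
  rcases Nat.lt_or_ge r 2 with h | h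
  · obtain rfl : r = 1 := by omega
    refine (probEKR_le_one le_rfl (by omega)).trans ?_
    have : ρ = 0 := by simp [hρ]
    rw [this, zero_mul, add_zero, div_one]
    linarith
  refine (probEKR_le_of_pair h (by omega)).trans ?_
  have hNpos : (0 : ℝ) < (n - 1).choose (r - 1) := by
    exact_mod_cast Nat.choose_pos (by omega)
  have hCpos : (0 : ℝ) < (n - (2 * r - 1)).choose (r - 2) := by
    exact_mod_cast Nat.choose_pos (by omega)
  have hb : ((n - 1).choose (r - 1) : ℝ) * (ρ * Real.exp (-(4 * (r ^ 2 / n)))) ≤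
      ((r - 1) ^ 2 * (n - (2 * r - 1)).choose (r - 2) : ℕ) := by
    have h1 := choose_ratio_sub_two_mul_pred h hn
    rw [div_le_iff₀ hCpos] at h1
    have h2 : ((n - 1).choose (r - 1) : ℝ) * ρ = ((r : ℝ) - 1) ^ 2 * (n - 2).choose (r - 2) := by
      rw [hρ, mul_div_assoc', div_eq_iff hn1.ne', mul_assoc, mul_comm _ ((n : ℝ) - 1),
        pred_mul_choose_pred h (by omega)]
      ring
    rw [← mul_assoc, h2, Nat.cast_mul, Nat.cast_pow, Nat.cast_sub hr, Nat.cast_one, mul_assoc]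
    gcongr
    calc _ ≤ Real.exp (4 * (r ^ 2 / n)) * (n - (2 * r - 1)).choose (r - 2) *
          Real.exp (-(4 * (r ^ 2 / n))) := by gcongr
      _ = (n - (2 * r - 1)).choose (r - 2) *
          (Real.exp (4 * (r ^ 2 / n)) * Real.exp (-(4 * (r ^ 2 / n)))) := by ring
      _ = _ := by rw [← Real.exp_add, add_neg_cancel, Real.exp_zero, mul_one]
  refine add_le_add ?_ (sub_le_sub_right (choose_ratio_sub hr hn) 1)
  calc _ ≤ ((n - 1).choose (r - 1) : ℝ) / ((n - 1).choose (r - 1) +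
        (n - 1).choose (r - 1) * (ρ * Real.exp (-(4 * (r ^ 2 / n))))) := by gcongr
    _ = _ := by
      rw [← mul_one_add, div_mul_eq_div_div, div_self hNpos.ne']

theorem probEKR_le_of_sq_le (hr : 2 ≤ r) (hn : 6 * r ≤ n) (h : (r : ℝ) ^ 2 ≤ 4 * n) :
    probEKR n r ≤ (2 / r + 8 * Real.exp 16 * (n / r ^ 3)) * Real.exp 8 := by
  have hr' : (2 : ℝ) ≤ r := by exact_mod_cast hr
  have hn' : (6 : ℝ) * r ≤ n := by exact_mod_cast hn
  have hn0 : (0 : ℝ) < n := by linarith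
  have hy : (r : ℝ) ^ 2 / n ≤ 4 := by
    rwa [div_le_iff₀ hn0]
  have hC : (0 : ℝ) < (n - 2 * r).choose (r - 2) := by
    exact_mod_cast Nat.choose_pos (by omega)
  refine (probEKR_le_of_triple hr (by omega)).trans ?_
  have h1 : ((n - 1).choose (r - 1) : ℝ) / (n - r).choose (r - 1) ≤ Real.exp 8 :=
    (choose_ratio_sub (by omega) hn).trans (Real.exp_le_exp.mpr (by linarith))
  have h2 : ((n - 2).choose (r - 2) : ℝ) / (n - 2 * r).choose (r - 2) ≤ Real.exp 16 :=
    (choose_ratio_sub_two_mul hr hn).trans (Real.exp_le_exp.mpr (by linarith))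
  have h3 : ((n - 1).choose (r - 1) : ℝ) / ((r / 2) ^ 2 * (n - 2 * r).choose (r - 2)) ≤
      8 * Real.exp 16 * (n / r ^ 3) := by
    have hN : ((n - 1).choose (r - 1) : ℝ) = (n - 1) / (r - 1) * (n - 2).choose (r - 2) := by
      rw [div_mul_eq_mul_div, eq_div_iff (by linarith), pred_mul_choose_pred hr (by omega)]
    have h4 : ((n : ℝ) - 1) / (r - 1) ≤ 2 * n / r := by
      rw [div_le_div_iff₀ (by linarith) (by linarith)]
      nlinarith
    calc ((n - 1).choose (r - 1) : ℝ) / ((r / 2) ^ 2 * (n - 2 * r).choose (r - 2))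
        = (n - 1) / (r - 1) * (((n - 2).choose (r - 2) : ℝ) / (n - 2 * r).choose (r - 2)) /
          (r / 2) ^ 2 := by
          rw [hN]
          field_simp
      _ ≤ 2 * n / r * Real.exp 16 / (r / 2) ^ 2 := by gcongr
      _ = _ := by
          field_simp
          norm_num
  gcongr

/-- Two `r`-sets are disjoint with probability at most `exp (-r²/n)`, so during the first `m`
choices a fraction `η` of all `r`-sets remains admissible, while a fraction `r / n` contains a given
element. -/
theorem probEKR_le_of_disjointness {m : ℕ} (hr : 1 ≤ r) (hn : 2 * r < n) (hm : m ≤ n) {η : ℝ}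
    (hη : 0 < η) (h : (m : ℝ) * (Real.exp (-(r ^ 2 / n)) + 1 / n) ≤ 1 - η) :
    probEKR n r ≤ n * (r / n / η) ^ m := by
  have hn0 : (0 : ℝ) < n := by exact_mod_cast (by omega : 0 < n)
  have hC : (n : ℝ) ≤ n.choose r := by
    exact_mod_cast le_choose_of_pos_of_lt hr (by omega : r < n)
  have hC0 : (0 : ℝ) < n.choose r := by linarith
  have h1 : ((n - r).choose r : ℝ) ≤ n.choose r * Real.exp (-(r ^ 2 / n)) := by
    have := choose_le_choose_add_mul_exp (n - r) r r (by omega)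
    rw [← Nat.cast_add, Nat.sub_add_cancel (by omega)] at this
    rwa [← sq] at this
  have h2 : (1 : ℝ) ≤ n.choose r * (1 / n) := by
    rw [mul_one_div, one_le_div hn0]
    exact hC
  refine (probEKR_le_of_prefix hr hn (m := m) (D := n.choose r * η)
    (hm.trans (le_choose_of_pos_of_lt hr (by omega))) (by positivity) ?_).trans (le_of_eq ?_)
  · calc (n.choose r : ℝ) * η ≤
          n.choose r * (1 - m * (Real.exp (-(r ^ 2 / n)) + 1 / n)) := by
            gcongr
            linarith
      _ = n.choose r - m * (n.choose r * Real.exp (-(r ^ 2 / n)) + n.choose r * (1 / n)) := by ring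
      _ ≤ _ := by gcongr
  · congr 2
    have := mul_choose_pred hr (by omega : r ≤ n)
    rw [div_div, div_eq_div_iff (by positivity) (by positivity)]
    linear_combination η * this

end Limits

/-! ### Passage to the limit. -/

section Limits

theorem tendsto_probEKR_of_tendsto {r : ℕ → ℕ} {c : ℕ → ℝ}
    (h : ∀ᶠ n in atTop, 1 ≤ r n ∧ 2 * r n < n ∧ (r n : ℝ) = c n * (n : ℝ) ^ ((1 : ℝ) / 3))
    {c₀ : ℝ} (hc : Tendsto c atTop (𝓝 c₀)) :
    Tendsto (fun n => probEKR n (r n)) atTop (𝓝 (1 / (1 + c₀ ^ 3))) := by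
  set w : ℕ → ℝ := fun n => (n : ℝ) ^ ((1 : ℝ) / 3) with hw
  have hwtop : Tendsto w atTop atTop :=
    (tendsto_rpow_atTop (by norm_num)).comp tendsto_natCast_atTop_atTop
  have hw3 : ∀ n : ℕ, w n ^ 3 = n := fun n => by
    rw [hw, ← Real.rpow_natCast, ← Real.rpow_mul (Nat.cast_nonneg n)]
    norm_num
  have hwinv : Tendsto (fun n => (w n)⁻¹) atTop (𝓝 0) := hwtop.inv_tendsto_atTop
  have hwpos : ∀ᶠ n in atTop, 0 < w n := hwtop.eventually_gt_atTop 0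
  have hrw : ∀ᶠ n in atTop, (r n : ℝ) = c n * w n := h.mono fun n hn => hn.2.2
  -- Keeps the limiting denominator `1 + c₀ ^ 3` away from `0`.
  have hc0 : 0 ≤ c₀ := by
    refine ge_of_tendsto hc ?_
    filter_upwards [h, hwpos] with n hn hwn
    by_contra! hneg
    have : (0 : ℝ) ≤ r n := Nat.cast_nonneg _
    nlinarith [hn.2.2]
  have hy : Tendsto (fun n => (r n : ℝ) ^ 2 / n) atTop (𝓝 0) := by
    have : Tendsto (fun n => c n ^ 2 * (w n)⁻¹) atTop (𝓝 (c₀ ^ 2 * 0)) := (hc.pow 2).mul hwinv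
    rw [mul_zero] at this
    refine this.congr' ?_
    filter_upwards [hrw, hwpos] with n hn hwn
    rw [hn, ← hw3 n]
    field_simp
  have hρ : Tendsto (fun n => ((r n : ℝ) - 1) ^ 3 / (n - 1)) atTop (𝓝 (c₀ ^ 3)) := by
    have : Tendsto (fun n => (c n - (w n)⁻¹) ^ 3 / (1 - ((w n)⁻¹) ^ 3)) atTop
        (𝓝 ((c₀ - 0) ^ 3 / (1 - 0 ^ 3))) :=
      ((hc.sub hwinv).pow 3).div (tendsto_const_nhds.sub (hwinv.pow 3)) (by norm_num)
    rw [sub_zero, zero_pow (by norm_num), sub_zero, div_one] at this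
    refine this.congr' ?_
    filter_upwards [hrw, hwpos] with n hn hwn
    rw [hn, ← hw3 n]
    have e1 : c n * w n - 1 = (c n - (w n)⁻¹) * w n := by field_simp
    have e2 : w n ^ 3 - 1 = (1 - (w n)⁻¹ ^ 3) * w n ^ 3 := by field_simp
    rw [e1, e2, mul_pow, mul_div_mul_right _ _ (by positivity)]
  have hsmall : ∀ᶠ n in atTop, 6 * r n ≤ n := by
    have : Tendsto (fun n => c n * ((w n)⁻¹) ^ 2) atTop (𝓝 (c₀ * 0 ^ 2)) :=
      hc.mul (hwinv.pow 2)
    rw [zero_pow (by norm_num), mul_zero] at this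
    filter_upwards [hrw, hwpos, this.eventually_le_const (by norm_num : (0 : ℝ) < 1 / 6)]
      with n hn hwn hle
    have h1 : (r n : ℝ) = c n * (w n)⁻¹ ^ 2 * n := by
      rw [hn, ← hw3 n]
      field_simp
    have h2 : (6 : ℝ) * r n ≤ n := by
      rw [h1]
      nlinarith [(Nat.cast_nonneg n : (0 : ℝ) ≤ n)]
    exact_mod_cast h2
  have hexp : ∀ a : ℝ, Tendsto (fun n => Real.exp (a * ((r n : ℝ) ^ 2 / n))) atTop (𝓝 1) := by
    intro a
    have := (Real.continuous_exp.tendsto _).comp (hy.const_mul a)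
    rwa [mul_zero, Real.exp_zero] at this
  have hpos : 0 < 1 + c₀ ^ 3 := by positivity
  have hn1 : Tendsto (fun n : ℕ => 2 / ((n : ℝ) - 1)) atTop (𝓝 0) :=
    (tendsto_atTop_add_const_right _ (-1) tendsto_natCast_atTop_atTop).const_div_atTop 2
  refine tendsto_of_tendsto_of_tendsto_of_le_of_le'
    (g := fun n => 1 - (((r n : ℝ) - 1) ^ 3 / (n - 1) /
      (1 - 2 / ((n : ℝ) - 1) + ((r n : ℝ) - 1) ^ 3 / (n - 1)) +
        2 * (Real.exp (2 * ((r n : ℝ) ^ 2 / n)) - 1)))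
    (h := fun n => 1 / (1 + ((r n : ℝ) - 1) ^ 3 / (n - 1) *
      Real.exp (-(4 * ((r n : ℝ) ^ 2 / n)))) + (Real.exp (2 * ((r n : ℝ) ^ 2 / n)) - 1)) ?_ ?_ ?_ ?_
  · have := ((hρ.div ((hn1.const_sub 1).add hρ) (by rw [sub_zero]; exact hpos.ne')).add
      (((hexp 2).sub_const 1).const_mul 2)).const_sub 1
    refine this.trans (le_of_eq ?_)
    congr 1
    rw [sub_zero, sub_self, mul_zero, add_zero]
    field_simp
    ring
  · have hexp4 : Tendsto (fun n => Real.exp (-(4 * ((r n : ℝ) ^ 2 / n)))) atTop (𝓝 1) := by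
      simpa only [neg_mul] using hexp (-4)
    have := ((tendsto_const_nhds (x := (1 : ℝ))).div ((hρ.mul hexp4).const_add 1)
      (by rw [mul_one]; exact hpos.ne')).add ((hexp 2).sub_const 1)
    rwa [mul_one, sub_self, add_zero] at this
  · filter_upwards [h, hsmall] with n hn h6
    linarith [one_sub_probEKR_le_of_small hn.1 h6 rfl]
  · filter_upwards [h, hsmall] with n hn h6
    exact probEKR_le_of_small hn.1 h6 rfl

theorem tendsto_nat_sqrt_atTop : Tendsto Nat.sqrt atTop atTop :=
  tendsto_atTop_mono' _ (Eventually.of_forall fun _ => le_rfl)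
    (tendsto_atTop_atTop.mpr fun b => ⟨b * b, fun _ ha => Nat.le_sqrt.mpr ha⟩)

theorem tendsto_mul_two_thirds_pow_sqrt :
    Tendsto (fun n : ℕ => (n : ℝ) * (2 / 3) ^ n.sqrt) atTop (𝓝 0) := by
  have h1 : Tendsto (fun s : ℕ => 4 * ((s : ℝ) ^ 2 * (2 / 3) ^ s)) atTop (𝓝 (4 * 0)) :=
    (tendsto_pow_const_mul_const_pow_of_abs_lt_one 2 (by rw [abs_of_pos] <;> norm_num)).const_mul 4
  rw [mul_zero] at h1
  refine squeeze_zero' (Eventually.of_forall fun n => by positivity) ?_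
    (h1.comp tendsto_nat_sqrt_atTop)
  filter_upwards [eventually_ge_atTop 1] with n hn
  have h2 : 1 ≤ n.sqrt := Nat.le_sqrt.mpr (by simpa using hn)
  have h3 : n ≤ 4 * n.sqrt ^ 2 := by
    have := Nat.lt_succ_sqrt n
    simp only [Nat.succ_eq_add_one] at this
    nlinarith
  have h4 : (n : ℝ) ≤ 4 * (n.sqrt : ℝ) ^ 2 := by exact_mod_cast h3
  simp only [Function.comp_apply]
  calc (n : ℝ) * (2 / 3) ^ n.sqrt ≤ 4 * (n.sqrt : ℝ) ^ 2 * (2 / 3) ^ n.sqrt := by gcongr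
    _ = _ := by ring

theorem exp_neg_le_six_div_cube {y : ℝ} (hy : 0 < y) : Real.exp (-y) ≤ 6 / y ^ 3 := by
  have h := Real.pow_div_factorial_le_exp y hy.le 3
  rw [Real.exp_neg, show (6 : ℝ) / y ^ 3 = (y ^ 3 / (Nat.factorial 3 : ℕ))⁻¹ by
    rw [inv_div]; norm_num [Nat.factorial]]
  exact inv_anti₀ (by positivity) h

/-- The union bound with `m = 3`: as `3 * (6/64 + 1/16) ≤ 1/2`, half of all `r`-sets stay
admissible, and `n * (2r/n)³` is the bound. -/
theorem probEKR_le_of_four_mul_lt_sq {n r : ℕ} (hr : 1 ≤ r) (hn : 2 * r < n)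
    (h : (4 : ℝ) * n < (r : ℝ) ^ 2) (hn16 : 16 ≤ n) :
    probEKR n r ≤ 8 * ((r : ℝ) ^ 3 / n ^ 2) := by
  have hn0 : (0 : ℝ) < n := by exact_mod_cast (by omega : 0 < n)
  have hn16' : (16 : ℝ) ≤ n := by exact_mod_cast hn16
  have hy : (4 : ℝ) < (r : ℝ) ^ 2 / n := by rwa [lt_div_iff₀ hn0]
  have h1 : Real.exp (-((r : ℝ) ^ 2 / n)) ≤ 6 / 64 :=
    (exp_neg_le_six_div_cube (by linarith)).trans (by
      have : (64 : ℝ) ≤ ((r : ℝ) ^ 2 / n) ^ 3 := by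
        calc (64 : ℝ) = 4 ^ 3 := by norm_num
          _ ≤ _ := by gcongr
      gcongr)
  have h2 : 1 / (n : ℝ) ≤ 1 / 16 := by gcongr
  refine (probEKR_le_of_disjointness (m := 3) (η := 1 / 2) hr hn (by omega) (by norm_num)
    (by push_cast; linarith)).trans (le_of_eq ?_)
  field_simp
  norm_num

/-- The hypothesis gives `(r²/n)³ ≥ δ² n`, hence a disjointness probability of order `1/n`. Even
`√n` choices leave three quarters of all sets admissible, and `(r/n) / (3/4) ≤ 2/3`. -/
theorem probEKR_le_of_lt_cube {n r : ℕ} {δ : ℝ} (hδ : 0 < δ) (hr : 1 ≤ r) (hn : 2 * r < n)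
    (h : δ * (n : ℝ) ^ 2 < (r : ℝ) ^ 3)
    (hδn : (n.sqrt : ℝ)⁻¹ * (6 / δ ^ 2 + 1) ≤ 1 / 4) :
    probEKR n r ≤ n * (2 / 3) ^ n.sqrt := by
  have hn0 : (0 : ℝ) < n := by exact_mod_cast (by omega : 0 < n)
  have hr0 : (0 : ℝ) < r := by exact_mod_cast hr
  have hs : 1 ≤ n.sqrt := Nat.le_sqrt.mpr (by omega)
  have hs0 : (0 : ℝ) < n.sqrt := by exact_mod_cast hs
  have hsn : (n.sqrt : ℝ) ^ 2 ≤ n := by exact_mod_cast Nat.sqrt_le' n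
  have h1 : Real.exp (-((r : ℝ) ^ 2 / n)) ≤ 6 / δ ^ 2 / n := by
    refine (exp_neg_le_six_div_cube (by positivity)).trans ?_
    rw [div_div]
    have h2 : δ ^ 2 * n ≤ ((r : ℝ) ^ 2 / n) ^ 3 := by
      rw [div_pow, le_div_iff₀ (by positivity)]
      calc δ ^ 2 * n * (n : ℝ) ^ 3 = (δ * (n : ℝ) ^ 2) ^ 2 := by ring
        _ ≤ ((r : ℝ) ^ 3) ^ 2 := by gcongr
        _ = _ := by ring
    gcongr
  have hrn : (r : ℝ) / n ≤ 1 / 2 := by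
    rw [div_le_div_iff₀ hn0 (by norm_num)]
    have : (2 : ℝ) * r < n := by exact_mod_cast hn
    linarith
  refine (probEKR_le_of_disjointness (m := n.sqrt) (η := 3 / 4) hr hn (Nat.sqrt_le_self n)
    (by norm_num) ?_).trans ?_
  · calc (n.sqrt : ℝ) * (Real.exp (-((r : ℝ) ^ 2 / n)) + 1 / n)
        ≤ n.sqrt * (6 / δ ^ 2 / n + 1 / n) := by gcongr
      _ = n.sqrt / n * (6 / δ ^ 2 + 1) := by ring
      _ ≤ (n.sqrt : ℝ)⁻¹ * (6 / δ ^ 2 + 1) := by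
          gcongr
          rw [div_le_iff₀ hn0, inv_mul_eq_div, le_div_iff₀ hs0, ← sq]
          exact hsn
      _ ≤ 1 - 3 / 4 := by linarith
  · have : (r : ℝ) / n / (3 / 4) ≤ 2 / 3 := by linarith
    gcongr

theorem tendsto_probEKR_zero {r : ℕ → ℕ} {c : ℕ → ℝ}
    (h : ∀ᶠ n in atTop, 1 ≤ r n ∧ 2 * r n < n ∧ (r n : ℝ) = c n * (n : ℝ) ^ ((1 : ℝ) / 3))
    (hc : Tendsto c atTop atTop) : Tendsto (fun n => probEKR n (r n)) atTop (𝓝 0) := by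
  have hc3 : ∀ᶠ n in atTop, (r n : ℝ) ^ 3 = c n ^ 3 * n := by
    filter_upwards [h] with n hn
    rw [hn.2.2, mul_pow, ← Real.rpow_natCast ((n : ℝ) ^ ((1 : ℝ) / 3)),
      ← Real.rpow_mul (Nat.cast_nonneg n)]
    norm_num
  have hrtop : Tendsto (fun n => (r n : ℝ)) atTop atTop := by
    have : Tendsto (fun n : ℕ => c n * (n : ℝ) ^ ((1 : ℝ) / 3)) atTop atTop :=
      hc.atTop_mul_atTop₀ ((tendsto_rpow_atTop (by norm_num)).comp tendsto_natCast_atTop_atTop)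
    refine this.congr' ?_
    filter_upwards [h] with n hn
    exact hn.2.2.symm
  have hratio : Tendsto (fun n : ℕ => (n : ℝ) / (r n : ℝ) ^ 3) atTop (𝓝 0) := by
    have : Tendsto (fun n => (c n ^ 3)⁻¹) atTop (𝓝 0) :=
      ((tendsto_pow_atTop (by norm_num)).comp hc).inv_tendsto_atTop
    refine this.congr' ?_
    filter_upwards [hc3, eventually_gt_atTop 0] with n hn hn0
    have : (n : ℝ) ≠ 0 := by exact_mod_cast hn0.ne'
    rw [hn, div_mul_cancel_right₀ this]
  have hB : Tendsto (fun n : ℕ => (2 / (r n : ℝ) + 8 * Real.exp 16 * (n / (r n : ℝ) ^ 3)) *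
      Real.exp 8) atTop (𝓝 0) := by
    have := ((hrtop.const_div_atTop 2).add (hratio.const_mul (8 * Real.exp 16))).mul_const
      (Real.exp 8)
    simpa using this
  refine tendsto_order.2 ⟨fun a ha => Eventually.of_forall fun n => ha.trans_le probEKR_nonneg,
    fun ε hε => ?_⟩
  have hsqrt : Tendsto (fun n : ℕ => (n.sqrt : ℝ)⁻¹ * (6 / (ε / 16) ^ 2 + 1)) atTop (𝓝 0) := by
    have := ((tendsto_natCast_atTop_atTop (R := ℝ)).comp
      tendsto_nat_sqrt_atTop).inv_tendsto_atTop.mul_const (6 / (ε / 16) ^ 2 + 1)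
    rwa [zero_mul] at this
  -- The threshold `144` turns `r² ≤ 4n` into `(6r)² ≤ n²`.
  filter_upwards [h, hrtop.eventually_ge_atTop 2, eventually_ge_atTop 144,
    hB.eventually_lt_const hε, tendsto_mul_two_thirds_pow_sqrt.eventually_lt_const hε,
    hsqrt.eventually_le_const (by norm_num : (0 : ℝ) < 1 / 4)] with n hn hr2 hn144 hBn hgn hsn
  have hn0 : (144 : ℝ) ≤ n := by exact_mod_cast hn144
  rcases le_or_gt ((r n : ℝ) ^ 2) (4 * n) with h1 | h1
  · refine (probEKR_le_of_sq_le (by exact_mod_cast hr2) ?_ h1).trans_lt hBn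
    have : (6 * r n : ℝ) ≤ n := by
      refine (sq_le_sq₀ (by positivity) (by linarith)).mp ?_
      nlinarith
    exact_mod_cast this
  -- With the cut at `ε / 16` the factor `8` of the middle range yields `ε / 2`.
  rcases le_or_gt ((r n : ℝ) ^ 3) (ε / 16 * (n : ℝ) ^ 2) with h2 | h2
  · refine (probEKR_le_of_four_mul_lt_sq hn.1 hn.2.1 h1 (by omega)).trans_lt ?_
    rw [← div_le_iff₀ (by positivity)] at h2
    linarith
  · exact (probEKR_le_of_lt_cube (by positivity) hn.1 hn.2.1 h2 hsn).trans_lt hgn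

end Limits

theorem theorem1 :
    (∀ n r : ℕ, 1 ≤ r → 2 * r < n → ∀ F ∈ (outputLaw n r).support,
      (F ∈ ekrEvent n r ↔ ∃ x : Fin n, FixedBy F x)) ∧
    (∀ (r : ℕ → ℕ) (c : ℕ → ℝ),
      (∀ᶠ n in atTop, 1 ≤ r n ∧ 2 * r n < n ∧ (r n : ℝ) = c n * (n : ℝ) ^ ((1 : ℝ) / 3)) →
      (Tendsto c atTop (𝓝 0) → Tendsto (fun n => probEKR n (r n)) atTop (𝓝 1)) ∧
      (∀ c₀ : ℝ, Tendsto c atTop (𝓝 c₀) →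
        Tendsto (fun n => probEKR n (r n)) atTop (𝓝 (1 / (1 + c₀ ^ 3)))) ∧
      (Tendsto c atTop atTop → Tendsto (fun n => probEKR n (r n)) atTop (𝓝 0))) := by
  refine ⟨fun n r hr hn F hF => mem_ekrEvent_iff hr hn hF, fun r c h => ⟨fun hc => ?_,
    fun c₀ hc => tendsto_probEKR_of_tendsto h hc, tendsto_probEKR_zero h⟩⟩
  simpa using tendsto_probEKR_of_tendsto h hc
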